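/- Let $1\le p<n$ be integers. For $i\in[1,p]$, $j\in[1,n]$, $k\in\mathbb N_0$ let $z_{i,j}^{(k)}$ be independent variables, let $Z(t)$ be the $p\times n$ matrix with entries $z_{i,j}(t)=\sum_{k\ge0}z_{i,j}^{(k)}t^k$, and for $I=(\alpha_1,\dots,\alpha_p)\in[1,n]^p$ let $D_I^{(k)}\in\mathbb C[\{z_{i,j}^{(k)}\}]$ be the coefficient of $t^k$ in the determinant of the $p\times p$ matrix whose $b$-th column is the $\alpha_b$-th column of $Z(t)$. The semi-infinite Plücker algebra $\tilde{\mathcal P}$ is the subalgebra of $\mathbb C[\{z_{i,j}^{(k)}\}]$ generated by all $D_I^{(k)}$, and $\tilde{\mathcal P}_m$ denotes its component of degree $m$, i.e. the span of all products of $m$ generators $D_I^{(k)}$. A tuple $(\beta_1,\dots,\beta_p)$ of pairwise distinct integers in $[1,n]$ is a PBW tuple if $\beta_j=j$ whenever $\beta_j\le p$, and $j<k$ whenever $\beta_j>\beta_k>p$. A semi-infinite tableau $T$ of shift $(k_1\le\dots\le k_m)$, $k_i\in\mathbb N_0$, consists of an integer $T_{i,j}$ for each $i\in[1,m]$ and $j\in[k_i+1,k_i+p]$.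 It is PBW-semistandard if every $(T_{i,k_i+1}-k_i,\dots,T_{i,k_i+p}-k_i)$ is a PBW tuple and, whenever both $T_{i,j}$ and $T_{i+1,j}$ are defined, there is $j'\ge j$ such that $T_{i+1,j'}$ is defined and $T_{i+1,j'}\ge T_{i,j}$. Put $I_i(T)=(T_{i,k_i+1}\bmod n,\dots,T_{i,k_i+p}\bmod n)$, with residues taken in $[1,n]$. Let $\tilde Q$ be the poset of elements $q_{i,j}$ with $i\ge1$, $j\ge p+1$, $0\le j-i\le n-1$, where $q_{i_1,j_1}\preceq q_{i_2,j_2}$ if and only if ($i_1\le i_2$ and $j_1\le j_2$) or $i_1+p\le i_2$ or $j_1+n-p\le j_2$. For $I=(\alpha_1,\dots,\alpha_p)\in[1,n]^p$ and $k\in\mathbb N_0$ let $\varphi(I^{(k)})$ be the order ideal of $\tilde Q$ generated by those elements $q_{k+i,\,k+(\alpha_i-k\bmod n)}$, $i\in[1,p]$, which lie in $\tilde Q$. Then: 1. The products $D_{I_1(T)}^{(k_1)}\cdots D_{I_m(T)}^{(k_m)}$, indexed by all $m\ge0$, all $k_1\le\dots\le k_m$ and all PBW-semistandard semi-infinite tableaux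 $T$ of shift $(k_1,\dots,k_m)$, form a basis of the vector space $\tilde{\mathcal P}$; those with a fixed $m$ form a basis of $\tilde{\mathcal P}_m$. 2. For every $m$ the map $T\mapsto(\varphi(I_1(T)^{(k_1)}),\dots,\varphi(I_m(T)^{(k_m)}))$ is a bijection from the set of PBW-semistandard semi-infinite tableaux with $m$ columns to the set of weakly increasing sequences $J_1\subseteq\dots\subseteq J_m$ of finite order ideals of $\tilde Q$. So the basis is equivalently indexed by such sequences. 3. (Graded character.) For all $m,d\in\mathbb N_0$ and $\mu\in\mathbb N_0^n$, the subspace of those elements of $\tilde{\mathcal P}_m$ that are combinations of monomials $\prod_s z_{i_s,j_s}^{(l_s)}$ with $\sum_s l_s=d$ and with $\mu_c$ factors (counted with multiplicity) satisfying $j_s=c$, for every $c\in[1,n]$, has finite dimension equal to the number of PBW-semistandard semi-infinite tableaux $T$ with $m$ columns, $k_1+\dots+k_m=d$ and exactly $\mu_c$ entries congruent to $c$ modulo $n$ for every $c\in[1,n]$. -/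

import Mathlib

/-- The index set of the variables `z_{i,j}^{(k)}`. The triple `(i, j, k)`, with `i : Fin p` and
`j : Fin n` counted from `0`, stands for the variable `z_{i+1,j+1}^{(k)}`. -/
abbrev ArcVar (n p : ℕ) : Type := Fin p × Fin n × ℕ

/-- The formal power series `z_{i,j}(t) = ∑_k z_{i,j}^{(k)} t^k`. -/
noncomputable def arcSeries (n p : ℕ) (i : Fin p) (j : Fin n) :
    PowerSeries (MvPolynomial (ArcVar n p) ℂ) :=
  PowerSeries.mk fun k => MvPolynomial.X (i, j, k)

/-- The polynomial `D_I^{(k)}`: the coefficient of `t^k` in the determinant of the `p × p` matrix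
whose `b`-th column is the `I b`-th column of the `p × n` matrix `(z_{i,j}(t))`. -/
noncomputable def arcMinor (n p : ℕ) (I : Fin p → Fin n) (k : ℕ) :
    MvPolynomial (ArcVar n p) ℂ :=
  PowerSeries.coeff k (Matrix.det (Matrix.of fun a b : Fin p => arcSeries n p a (I b)))

/-- The set of all polynomials `D_I^{(k)}`. -/
def arcMinors (n p : ℕ) : Set (MvPolynomial (ArcVar n p) ℂ) :=
  {f | ∃ (I : Fin p → Fin n) (k : ℕ), f = arcMinor n p I k}

/-- The semi-infinite Plücker algebra: the (unital) subalgebra generated by all `D_I^{(k)}`. -/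
noncomputable def semiInfPlucker (n p : ℕ) : Subalgebra ℂ (MvPolynomial (ArcVar n p) ℂ) :=
  Algebra.adjoin ℂ (arcMinors n p)

/-- The homogeneous component of degree `m` of the semi-infinite Plücker algebra, for the grading
in which every `D_I^{(k)}` has degree `1`: the span of all products of `m` generators. -/
noncomputable def semiInfPluckerComponent (n p m : ℕ) :
    Submodule ℂ (MvPolynomial (ArcVar n p) ℂ) :=
  Submodule.span ℂ (arcMinors n p) ^ m

/-- The column of number `a mod n`, the representative being taken in `{1, …, n}`; since `Fin n`
counts from `0`, its index is `(a - 1) mod n`. -/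
def columnMod (n : ℕ) [NeZero n] (a : ℤ) : Fin n :=
  ⟨((a - 1) % (n : ℤ)).toNat, by
    have h : (0 : ℤ) < n := by exact_mod_cast Nat.pos_of_ne_zero (NeZero.ne n)
    have h1 := Int.emod_nonneg (a - 1) h.ne'
    have h2 := Int.emod_lt_of_pos (a - 1) h
    omega⟩

/-- A PBW tuple `(β_1, …, β_p)` of integers in `[1, n]` (here `β_{j+1}` is `β j`): pairwise
distinct entries, entries at most `p` stand in the positions equal to their values, and the
entries greater than `p` decrease. -/
def IsPBWTuple (n p : ℕ) (β : Fin p → ℤ) : Prop :=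
  (∀ j, 1 ≤ β j ∧ β j ≤ n) ∧
  Function.Injective β ∧
  (∀ j, β j ≤ p → β j = (j : ℕ) + 1) ∧
  (∀ j k, β k < β j → (p : ℤ) < β k → j < k)

/-- A semi-infinite tableau with `m` columns of height `p`. Its shift is the weakly increasing
sequence `shift`; the integer `content i j` is written in the `(j+1)`-st box from the bottom of
the column `i`, which is the box at height `shift i + j + 1`. -/
@[ext]
structure SemiInfTableau (p m : ℕ) where
  /-- the shift `k_1 ≤ … ≤ k_m` -/
  shift : Fin m → ℕ
  shift_mono : Monotone shift
  /-- the contents of the boxes -/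
  content : Fin m → Fin p → ℤ

namespace SemiInfTableau

variable {p m : ℕ}

/-- PBW-semistandardness: every column becomes a PBW tuple once its shift is subtracted, and for
any two boxes of equal height in consecutive columns `i` and `i'`, the column `i'` has a box of
this or of greater height whose content is at least that of the box in the column `i`. -/
def IsPBWSemistandard (n : ℕ) (T : SemiInfTableau p m) : Prop :=
  (∀ i, IsPBWTuple n p fun j => T.content i j - (T.shift i : ℤ)) ∧
  (∀ i i' : Fin m, (i' : ℕ) = (i : ℕ) + 1 → ∀ j j' : Fin p,
    T.shift i + (j : ℕ) = T.shift i' + (j' : ℕ) →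
      ∃ j'' : Fin p, j' ≤ j'' ∧ T.content i j ≤ T.content i' j'')

/-- The tuple `I_i(T)` of the contents modulo `n` of the column `i`. -/
def columnTuple (n : ℕ) [NeZero n] (T : SemiInfTableau p m) (i : Fin m) : Fin p → Fin n :=
  fun j => columnMod n (T.content i j)

/-- The product `D_{I_1(T)}^{(k_1)} ⋯ D_{I_m(T)}^{(k_m)}`. -/
noncomputable def minorProduct (n : ℕ) [NeZero n] (T : SemiInfTableau p m) :
    MvPolynomial (ArcVar n p) ℂ :=
  ∏ i, arcMinor n p (T.columnTuple n i) (T.shift i)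

/-- The number of boxes of `T` whose content modulo `n` is the column number given by `c`. -/
def multiplicity (n : ℕ) [NeZero n] (T : SemiInfTableau p m) (c : Fin n) : ℕ :=
  (Finset.univ.filter fun x : Fin m × Fin p => T.columnTuple n x.1 x.2 = c).card

end SemiInfTableau

/-- The elements `q_{i,j}` of the poset, with `i ≥ 1`, `j ≥ p + 1` and `0 ≤ j - i ≤ n - 1`. -/
@[ext]
structure CylPoset (n p : ℕ) where
  /-- the first index -/
  i : ℤ
  /-- the second index -/
  j : ℤ
  one_le_i : 1 ≤ i
  lt_j : (p : ℤ) + 1 ≤ j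
  i_le_j : 0 ≤ j - i
  j_le : j - i ≤ (n : ℤ) - 1

/-- The order relation of the poset (it is a partial order when `1 ≤ p < n`). -/
instance (n p : ℕ) : LE (CylPoset n p) where
  le a b := (a.i ≤ b.i ∧ a.j ≤ b.j) ∨ a.i + (p : ℤ) ≤ b.i ∨ a.j + (n : ℤ) - (p : ℤ) ≤ b.j

/-- The order ideal attached to `I^{(k)}`: it is generated by the elements
`q_{k+i, k + (α_i - k mod n)}` with `1 ≤ i ≤ p` and `k + (α_i - k mod n) > p`, where
`I = (α_1, …, α_p)` and residues modulo `n` are taken in `[1, n]`. As `Fin` counts from `0`,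
`α_{a+1}` is `I a + 1` and its residue after subtracting `k` is `(I a - k) % n + 1`. -/
def pbwIdeal (n p : ℕ) (I : Fin p → Fin n) (k : ℕ) : Set (CylPoset n p) :=
  {x | ∃ (a : Fin p) (q : CylPoset n p),
    q.i = (k : ℤ) + ((a : ℕ) + 1) ∧
    q.j = (k : ℤ) + ((((I a : ℕ) : ℤ) - (k : ℤ)) % (n : ℤ) + 1) ∧
    x ≤ q}

/-- The weight of the variable `z_{i,j}^{(k)}`: its column number, recorded as a standard basis
vector of `ℕ^n`, together with its degree `k` in `t`. -/
def arcWeight (n p : ℕ) : ArcVar n p → (Fin n → ℕ) × ℕ :=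
  fun v => (Pi.single v.2.1 1, v.2.2)

/-! Two opposite estimates meet in a count of chains of order ideals.

A finite order ideal is determined by its largest diagonal element `q_{k+p,k+p}`, which gives the
shift `k` (zero if there is none), and by a staircase in the rectangle `k < i ≤ k + p`, `k + p < j ≤
k + n`, whose corners are the entries above `p` of a PBW tuple. Inclusion of these ideals is the
semistandardness condition, whence `bijOn_pbwIdeal`.

Independence comes from leading monomials. Place `z_{i,j}^{(l)}`, with `i` counted from `0`, at
height `i + p * l`. For the weight `arcCost`, the unique cheapest monomial of `D_I^{(k)}` puts the
`b`-th column at height `k + b` (`hasLeastExponent_arcMinor`). The leading monomial of a product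
records which contents occur at which heights, and this determines a semistandard tableau
(`eq_of_sum_eq`).

Spanning needs no straightening relations. Minors, hence their products, are invariant under
subtracting `t ^ ε` times one row of `Z(t)` from another. Invariance forces a monomial of largest
`diagonalWeight` in a nonzero combination to be made of cylindric sequences
(`exists_isCylindric_of_mem_minorProductSpan`), so the coefficients at cylindric exponents determine
the combination. Chains of cylindric sequences embed into chains of finite order ideals, compatibly
with the degree in `t`. Hence for fixed `m` and `d` the dimension is at most the number of tableaux,
and the independent products fill the space (`minorProductSpan_eq_span`). The character follows
because each product is homogeneous. -/

/-! ### PBW tuples and finite order ideals. -/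

namespace IsPBWTuple

variable {n p : ℕ} {β : Fin p → ℤ}

theorem succ_le (h : IsPBWTuple n p β) (a : Fin p) : (a : ℤ) + 1 ≤ β a := by
  by_contra hlt
  have h1 := h.2.2.1 a (by omega)
  omega

theorem apply_lt_apply (h : IsPBWTuple n p β) {a b : Fin p} (hab : a < b) (ha : (p : ℤ) < β a) :
    β b < β a := by
  rcases lt_trichotomy (β a) (β b) with h1 | h1 | h1
  · exact absurd (h.2.2.2 b a h1 ha) (by omega)
  · exact absurd (h.2.1 h1) hab.ne
  · exact h1

end IsPBWTuple

/-- The order ideal of the poset attached to the PBW tuple `β` and the degree `k`. -/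
def tupleIdeal (n p k : ℕ) (β : Fin p → ℤ) : Set (CylPoset n p) :=
  {x | x.i ≤ k ∨ x.j ≤ k + p ∨ ∃ a : Fin p, (p : ℤ) < β a ∧ x.i ≤ k + a + 1 ∧ x.j ≤ k + β a}

theorem CylPoset.le_def {n p : ℕ} (x y : CylPoset n p) :
    x ≤ y ↔ (x.i ≤ y.i ∧ x.j ≤ y.j) ∨ x.i + (p : ℤ) ≤ y.i ∨ x.j + (n : ℤ) - (p : ℤ) ≤ y.j :=
  Iff.rfl

/-- Entries at most `p` contribute only elements with `i ≤ k` or `j ≤ k + p`. For `k ≥ 1` all such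
elements already lie below the last generator, because the last entry is at least `p`; for `k = 0`
there are none. -/
theorem pbwIdeal_eq_tupleIdeal {n p k : ℕ} (hp : 1 ≤ p) {β : Fin p → ℤ}
    (h : IsPBWTuple n p β) {I : Fin p → Fin n}
    (hI : ∀ a, (((I a : ℕ) : ℤ) - (k : ℤ)) % (n : ℤ) + 1 = β a) :
    pbwIdeal n p I k = tupleIdeal n p k β := by
  have top : ∀ x : CylPoset n p, 1 ≤ k → (x.i + p ≤ k + p ∨ (x.i ≤ k + p ∧ x.j ≤ k + p)) →
      x ∈ pbwIdeal n p I k := by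
    intro x hk hx
    have h1 := h.succ_le ⟨p - 1, by omega⟩
    have h2 := h.1 ⟨p - 1, by omega⟩
    simp only at h1
    refine ⟨⟨p - 1, by omega⟩, ⟨k + p, k + β ⟨p - 1, by omega⟩, by omega, by omega, by omega,
      by omega⟩, ?_, ?_, ?_⟩
    · simp only; omega
    · simp only [hI]
    · simp only [CylPoset.le_def]; omega
  ext x
  have := x.one_le_i
  have := x.lt_j
  have := x.i_le_j
  have := x.j_le
  constructor
  · rintro ⟨a, q, h1, h2, h3⟩
    rw [hI] at h2
    have ha := a.2
    have hb := h.1 a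
    rw [CylPoset.le_def] at h3
    show _ ∨ _ ∨ _
    rcases h3 with ⟨h3, h4⟩ | h3 | h3
    · by_cases hc : (p : ℤ) < β a
      · exact Or.inr (Or.inr ⟨a, hc, by omega, by omega⟩)
      · exact Or.inr (Or.inl (by omega))
    · exact Or.inl (by omega)
    · exact Or.inr (Or.inl (by omega))
  · rintro (h1 | h1 | ⟨a, h1, h2, h3⟩)
    · exact top x (by omega) (by omega)
    · exact top x (by omega) (by omega)
    · have hb := h.1 a
      have hc := h.succ_le a
      refine ⟨a, ⟨k + a + 1, k + β a, by omega, by omega, by omega, by omega⟩, by simp only; omega,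
        by simp only [hI], Or.inl ⟨h2, h3⟩⟩

section tupleIdeal

variable {n p k k' : ℕ} {β β' : Fin p → ℤ}

/-- For `k ≥ 1` the element `q_{k+p,k+p}` lies in the smaller ideal, and it lies in an ideal of
shift `k'` only if `k ≤ k'`. -/
theorem shift_le_of_tupleIdeal_subset (hpn : p < n)
    (h : tupleIdeal n p k β ⊆ tupleIdeal n p k' β') : k ≤ k' := by
  rcases Nat.eq_zero_or_pos k with h0 | h0
  · omega
  · have hm : (⟨k + p, k + p, by omega, by omega, by omega, by omega⟩ : CylPoset n p) ∈
        tupleIdeal n p k β := Or.inr (Or.inl le_rfl)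
    rcases h hm with h1 | h1 | ⟨a, -, h1, -⟩ <;> simp only at h1
    · omega
    · omega
    · have := a.2
      omega

/-- Translates semistandardness of neighbouring columns into inclusion. It suffices to test the
corners `q_{k+j+1,k+β_j}`; those with `k + j < k'` lie in the larger ideal anyway, so only boxes at
common heights matter. -/
theorem tupleIdeal_subset_iff (hβ : IsPBWTuple n p β)
    (hβ' : IsPBWTuple n p β') (hk : k ≤ k') :
    tupleIdeal n p k β ⊆ tupleIdeal n p k' β' ↔
      ∀ j j' : Fin p, k + (j : ℕ) = k' + (j' : ℕ) → ∃ j'' : Fin p, j' ≤ j'' ∧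
        k + β j ≤ k' + β' j'' := by
  constructor
  · intro h j j' hj
    have hb := hβ.1 j
    have hc := hβ.succ_le j
    have hc' := hβ'.succ_le j'
    by_cases hjp : β j ≤ p
    · have := hβ.2.2.1 j hjp
      exact ⟨j', le_rfl, by omega⟩
    · have hm : (⟨k + j + 1, k + β j, by omega, by omega, by omega, by omega⟩ : CylPoset n p) ∈
          tupleIdeal n p k β := Or.inr (Or.inr ⟨j, by omega, le_rfl, le_rfl⟩)
      rcases h hm with h1 | h1 | ⟨a, h0, h1, h2⟩
      · simp only at h1
        omega
      · have h3 := hβ'.succ_le ⟨p - 1, by omega⟩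
        simp only at h1 h3
        refine ⟨⟨p - 1, by omega⟩, ?_, by omega⟩
        have := j'.2
        simp only [Fin.le_def]
        omega
      · simp only at h1 h2
        refine ⟨a, ?_, by omega⟩
        simp only [Fin.le_def]
        omega
  · rintro h x (h1 | h1 | ⟨a, h0, h1, h2⟩)
    · exact Or.inl (by omega)
    · exact Or.inr (Or.inl (by omega))
    · by_cases hx : x.i ≤ k'
      · exact Or.inl hx
      · have ha := a.2
        obtain ⟨j'', h3, h4⟩ := h a ⟨k + a - k', by omega⟩ (by simp only; omega)
        simp only [Fin.le_def] at h3
        by_cases hc : (p : ℤ) < β' j''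
        · exact Or.inr (Or.inr ⟨j'', hc, by omega, by omega⟩)
        · exact Or.inr (Or.inl (by omega))

/-- The large entries are the maximal corners of the staircase. Each corner of one description is
dominated by a corner of the other and conversely; since large entries decrease, going there and
back returns to the start. -/
theorem tupleIdeal_apply_eq (hβ : IsPBWTuple n p β) (hβ' : IsPBWTuple n p β')
    (h : tupleIdeal n p k β = tupleIdeal n p k β') {a : Fin p} (ha : (p : ℤ) < β a) :
    β a = β' a := by
  have key : ∀ {γ γ' : Fin p → ℤ}, IsPBWTuple n p γ →
      tupleIdeal n p k γ = tupleIdeal n p k γ' → ∀ {b : Fin p}, (p : ℤ) < γ b →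
      ∃ b', (p : ℤ) < γ' b' ∧ b ≤ b' ∧ γ b ≤ γ' b' := by
    intro γ γ' hγ he b hb
    have h1 := hγ.1 b
    have h2 := hγ.succ_le b
    have hm : (⟨k + b + 1, k + γ b, by omega, by omega, by omega, by omega⟩ : CylPoset n p) ∈
        tupleIdeal n p k γ := Or.inr (Or.inr ⟨b, hb, le_rfl, le_rfl⟩)
    rw [he] at hm
    rcases hm with h3 | h3 | ⟨b', h3, h4, h5⟩
    · simp only at h3
      omega
    · simp only at h3
      omega
    · simp only at h4 h5
      exact ⟨b', h3, by simp only [Fin.le_def]; omega, by omega⟩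
  obtain ⟨b, h1, h2, h3⟩ := key hβ h ha
  obtain ⟨c, h4, h5, h6⟩ := key hβ' h.symm h1
  have hac : a = c := by
    rcases (h2.trans h5).eq_or_lt with h7 | h7
    · exact h7
    · have := hβ.apply_lt_apply h7 ha
      omega
  subst hac
  have hab : a = b := le_antisymm h2 h5
  subst hab
  omega

theorem tupleIdeal_injective (hpn : p < n) (hβ : IsPBWTuple n p β) (hβ' : IsPBWTuple n p β')
    (h : tupleIdeal n p k β = tupleIdeal n p k' β') : k = k' ∧ β = β' := by
  have hk : k = k' := le_antisymm (shift_le_of_tupleIdeal_subset hpn h.subset)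
    (shift_le_of_tupleIdeal_subset hpn h.symm.subset)
  subst hk
  refine ⟨rfl, funext fun a => ?_⟩
  by_cases h1 : (p : ℤ) < β a
  · exact tupleIdeal_apply_eq hβ hβ' h h1
  · by_cases h2 : (p : ℤ) < β' a
    · exact (tupleIdeal_apply_eq hβ' hβ h.symm h2).symm
    · rw [hβ.2.2.1 a (by omega), hβ'.2.2.1 a (by omega)]

theorem isLowerSet_tupleIdeal (hpn : p < n) (hβ : IsPBWTuple n p β) :
    IsLowerSet (tupleIdeal n p k β) := by
  intro y x hxy hy
  have := x.i_le_j
  have := x.j_le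
  have := y.i_le_j
  have := y.j_le
  rw [CylPoset.le_def] at hxy
  rcases hy with h1 | h1 | ⟨a, h0, h1, h2⟩
  · rcases hxy with hxy | hxy | hxy
    · exact Or.inl (by omega)
    · exact Or.inl (by omega)
    · exact Or.inr (Or.inl (by omega))
  · rcases hxy with hxy | hxy | hxy
    · exact Or.inr (Or.inl (by omega))
    · exact Or.inl (by omega)
    · exact Or.inr (Or.inl (by omega))
  · have := a.2
    have := hβ.1 a
    rcases hxy with hxy | hxy | hxy
    · exact Or.inr (Or.inr ⟨a, h0, by omega, by omega⟩)
    · exact Or.inl (by omega)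
    · exact Or.inr (Or.inl (by omega))

theorem CylPoset.finite_of_i_le {s : Set (CylPoset n p)} (b : ℤ) (h : ∀ x ∈ s, x.i ≤ b) :
    s.Finite := by
  refine Set.Finite.of_finite_image (f := fun x : CylPoset n p => (x.i, x.j)) ?_ ?_
  · refine Set.Finite.subset ((Set.finite_Icc (1 : ℤ) b).prod (Set.finite_Icc (1 : ℤ) (b + n))) ?_
    rintro _ ⟨x, hx, rfl⟩
    have := x.one_le_i
    have := x.i_le_j
    have := x.j_le
    have := h x hx
    simp only [Set.mem_prod, Set.mem_Icc]
    omega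
  · intro x _ y _ hxy
    simp only [Prod.mk.injEq] at hxy
    exact CylPoset.ext hxy.1 hxy.2

theorem finite_tupleIdeal : (tupleIdeal n p k β).Finite := by
  refine CylPoset.finite_of_i_le (k + p : ℤ) ?_
  rintro x (h1 | h1 | ⟨a, -, h1, -⟩)
  · omega
  · have := x.i_le_j
    omega
  · have := a.2
    omega

/-- An order ideal of the rectangle is generated by the corners recorded in a PBW tuple. -/
theorem exists_isPBWTuple_of_antitone {n p : ℕ} (R : ℕ → ℤ → Prop)
    (hR : ∀ a v, R a v → a < p ∧ v ≤ n)
    (hdown : ∀ a a' v v', a ≤ a' → (p : ℤ) < v → v ≤ v' → R a' v' → R a v) (hpn : p < n) :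
    ∃ β : Fin p → ℤ, IsPBWTuple n p β ∧
      ∀ a v, (p : ℤ) < v → (R a v ↔ ∃ b : Fin p, (p : ℤ) < β b ∧ a ≤ b ∧ v ≤ β b) := by
  classical
  -- The outer corners of the staircase: each row has at most one, and rows without one receive the
  -- default value `a + 1`, as a PBW tuple requires.
  let C : ℕ → ℤ → Prop := fun a v => (p : ℤ) < v ∧ R a v ∧ ¬ R (a + 1) v ∧ ¬ R a (v + 1)
  have hCu : ∀ {a v w}, C a v → C a w → v = w := by
    intro a v w hv hw
    rcases lt_trichotomy v w with h | h | h
    · exact absurd (hdown a a (v + 1) w le_rfl (by have := hv.1; omega) (by omega) hw.2.1) hv.2.2.2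
    · exact h
    · exact absurd (hdown a a (w + 1) v le_rfl (by have := hw.1; omega) (by omega) hv.2.1) hw.2.2.2
  let β : Fin p → ℤ := fun a => if h : ∃ v, C a v then h.choose else a + 1
  have hβC : ∀ {a : Fin p} {v}, C a v → β a = v := by
    intro a v h
    have h' : ∃ v, C a v := ⟨v, h⟩
    simp only [β, dif_pos h']
    exact hCu h'.choose_spec h
  have hβ : ∀ a : Fin p, C a (β a) ∨ β a = a + 1 := by
    intro a
    by_cases h : ∃ v, C a v
    · left
      simp only [β, dif_pos h]
      exact h.choose_spec
    · right
      simp only [β, dif_neg h]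
  have hdec : ∀ {a b v w}, C a v → C b w → w < v → a < b := by
    intro a b v w hv hw hvw
    by_contra hab
    exact hw.2.2.2 (hdown b a (w + 1) v (by omega) (by have := hw.1; omega) (by omega) hv.2.1)
  refine ⟨β, ⟨?_, ?_, ?_, ?_⟩, ?_⟩
  · intro a
    rcases hβ a with h | h
    · have h1 := (hR _ _ h.2.1).2
      have h2 := h.1
      omega
    · have := a.2
      omega
  · intro a b hab
    rcases hβ a with h | h <;> rcases hβ b with h' | h'
    · rw [← hab] at h'
      by_contra hne
      rcases lt_or_gt_of_ne (fun hh => hne (Fin.ext hh) : (a : ℕ) ≠ b) with hlt | hlt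
      · exact h.2.2.1 (hdown _ _ _ _ hlt h.1 le_rfl h'.2.1)
      · exact h'.2.2.1 (hdown _ _ _ _ hlt h.1 le_rfl h.2.1)
    · have := h.1
      have := b.2
      omega
    · have := h'.1
      have := a.2
      omega
    · exact Fin.ext (by omega)
  · intro a ha
    rcases hβ a with h | h
    · have := h.1
      omega
    · exact h
  · intro a b hab hb
    have ha' := a.2
    have hb' := b.2
    rcases hβ a with h | h <;> rcases hβ b with h' | h'
    · exact hdec h h' hab
    all_goals omega
  · intro a v hv
    constructor
    · intro h
      obtain ⟨b, ⟨hb1, hb2⟩, hb3⟩ : ∃ b, (a ≤ b ∧ R b v) ∧ ¬ R (b + 1) v := by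
        by_contra hcon
        have : ∀ t, R (a + t) v := by
          intro t
          induction t with
          | zero => exact h
          | succ t ih =>
            by_contra h3
            exact hcon ⟨a + t, ⟨by omega, ih⟩, h3⟩
        have h3 := (hR _ _ (this p)).1
        omega
      obtain ⟨w, ⟨hw1, hw2⟩, hw3⟩ : ∃ w, (v ≤ w ∧ R b w) ∧ ¬ R b (w + 1) := by
        by_contra hcon
        have : ∀ t : ℕ, R b (v + t) := by
          intro t
          induction t with
          | zero => simpa using hb2
          | succ t ih =>
            by_contra h3
            exact hcon ⟨v + t, ⟨by omega, ih⟩, by rwa [add_assoc, ← Nat.cast_succ]⟩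
        have h3 := (hR _ _ (this (n + 1))).2
        omega
      have hbp := (hR _ _ hb2).1
      have hC : C b w := ⟨by omega, hw2,
        fun h4 => hb3 (hdown _ _ _ _ le_rfl hv hw1 h4), hw3⟩
      have := hβC (a := ⟨b, hbp⟩) hC
      exact ⟨⟨b, hbp⟩, by omega, hb1, by omega⟩
    · rintro ⟨b, h1, h2, h3⟩
      rcases hβ b with h | h
      · exact hdown _ _ _ _ h2 hv h3 h.2.1
      · have := b.2
        omega

/-- The largest diagonal element fixes `k`. Everything with `i ≤ k` or `j ≤ k + p` then lies in `J`,
nothing lies beyond `i = k + p` or `j = k + n`, and what remains is a staircase in a rectangle. -/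
theorem exists_tupleIdeal_eq (hpn : p < n) {J : Set (CylPoset n p)} (hJf : J.Finite)
    (hJ : IsLowerSet J) : ∃ (k : ℕ) (β : Fin p → ℤ), IsPBWTuple n p β ∧ tupleIdeal n p k β = J := by
  classical
  obtain ⟨k, hk, hk'⟩ : ∃ k : ℕ, (∀ x ∈ J, x.i = x.j → x.i ≤ k + p) ∧
      (k = 0 ∨ ∃ x ∈ J, x.i = k + p ∧ x.j = k + p) := by
    by_cases hne : {x ∈ J | x.i = x.j}.Nonempty
    · obtain ⟨x, hx, hmax⟩ := Set.exists_max_image _ (fun x : CylPoset n p => x.i)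
        (hJf.subset (Set.sep_subset _ _)) hne
      have h1 := x.lt_j
      have h2 : x.i = x.j := hx.2
      refine ⟨(x.i - p).toNat, fun y hy hy' => ?_, Or.inr ⟨x, hx.1, by omega, by omega⟩⟩
      have := hmax y ⟨hy, hy'⟩
      omega
    · refine ⟨0, fun x hx hx' => absurd ⟨x, hx, hx'⟩ hne, Or.inl rfl⟩
  have hbase : ∀ x : CylPoset n p, x.i ≤ k ∨ x.j ≤ k + p → x ∈ J := by
    intro x hx
    have := x.one_le_i
    have := x.lt_j
    have := x.i_le_j
    rcases hk' with h0 | ⟨y, hy, h1, h2⟩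
    · omega
    · refine hJ ?_ hy
      rw [CylPoset.le_def]
      omega
  have hbound : ∀ x ∈ J, x.i ≤ k + p ∧ x.j ≤ k + n := by
    intro x hx
    have := x.i_le_j
    have := x.one_le_i
    by_contra hcon
    -- An element outside the bounds would dominate the next diagonal element, against the
    -- maximality of `k`.
    have hq : (⟨k + p + 1, k + p + 1, by omega, by omega, by omega, by omega⟩ : CylPoset n p) ∈ J :=
      hJ (by rw [CylPoset.le_def]; simp only; omega) hx
    have := hk _ hq rfl
    simp only at this
    omega
  obtain ⟨β, hβ, hβR⟩ := exists_isPBWTuple_of_antitone (n := n) (p := p)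
    (fun a v => ∃ x ∈ J, x.i = k + a + 1 ∧ x.j = k + v)
    (by
      rintro a v ⟨x, hx, h1, h2⟩
      have := hbound x hx
      omega)
    (by
      rintro a a' v v' ha hv hv' ⟨x, hx, h1, h2⟩
      have := hbound x hx
      refine ⟨⟨k + a + 1, k + v, by omega, by omega, by omega, by omega⟩, hJ ?_ hx, rfl, rfl⟩
      rw [CylPoset.le_def]
      simp only
      omega) hpn
  refine ⟨k, β, hβ, Set.ext fun x => ⟨?_, ?_⟩⟩
  · rintro (h1 | h1 | ⟨a, h0, h1, h2⟩)
    · exact hbase x (Or.inl h1)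
    · exact hbase x (Or.inr h1)
    · obtain ⟨y, hy, h3, h4⟩ := (hβR a (β a) h0).2 ⟨a, h0, le_rfl, le_rfl⟩
      refine hJ ?_ hy
      rw [CylPoset.le_def]
      omega
  · intro hx
    by_cases h1 : x.i ≤ k
    · exact Or.inl h1
    by_cases h2 : x.j ≤ k + p
    · exact Or.inr (Or.inl h2)
    obtain ⟨b, h3, h4, h5⟩ := (hβR (x.i - k - 1).toNat (x.j - k) (by omega)).1
      ⟨x, hx, by omega, by omega⟩
    exact Or.inr (Or.inr ⟨b, h3, by omega, by omega⟩)

end tupleIdeal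

/-! ### Semistandard tableaux as chains of order ideals. -/

theorem Fin.monotone_of_consecutive {α : Type*} [Preorder α] {m : ℕ} {f : Fin m → α}
    (h : ∀ i i' : Fin m, (i' : ℕ) = i + 1 → f i ≤ f i') : Monotone f := by
  have key : ∀ (t : ℕ) (i i' : Fin m), (i' : ℕ) = i + t → f i ≤ f i' := by
    intro t
    induction t with
    | zero => intro i i' hi; rw [Fin.ext (hi.trans (add_zero _))]
    | succ t ih =>
      intro i i' hi
      have := i'.2
      exact (ih i ⟨i + t, by omega⟩ rfl).trans (h _ _ (by simp only; omega))
  intro i i' hi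
  exact key (i' - i) i i' (by have : (i : ℕ) ≤ i' := hi; omega)

namespace SemiInfTableau

variable {n p m : ℕ}

/-- The column `i` of a tableau with its shift subtracted. -/
def tuple (T : SemiInfTableau p m) (i : Fin m) (j : Fin p) : ℤ := T.content i j - T.shift i

theorem IsPBWSemistandard.isPBWTuple {T : SemiInfTableau p m} (hT : T.IsPBWSemistandard n)
    (i : Fin m) : IsPBWTuple n p (T.tuple i) := hT.1 i

theorem content_eq (T : SemiInfTableau p m) (i : Fin m) (j : Fin p) :
    T.content i j = T.shift i + T.tuple i j := by
  simp [tuple]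

theorem isPBWSemistandard_iff (T : SemiInfTableau p m) :
    T.IsPBWSemistandard n ↔ (∀ i, IsPBWTuple n p (T.tuple i)) ∧
      Monotone fun i => tupleIdeal n p (T.shift i) (T.tuple i) := by
  refine and_congr_right fun h1 => ?_
  have h1' : ∀ i, IsPBWTuple n p (T.tuple i) := h1
  constructor
  · intro h
    refine Fin.monotone_of_consecutive fun i i' hi => ?_
    refine (tupleIdeal_subset_iff (h1' i) (h1' i')
      (T.shift_mono (by simp only [Fin.le_def]; omega))).2 fun j j' hj => ?_
    simpa only [content_eq] using h i i' hi j j' hj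
  · intro h i i' hi
    have hi' : i ≤ i' := by simp only [Fin.le_def]; omega
    simpa only [content_eq] using (tupleIdeal_subset_iff (h1' i) (h1' i') (T.shift_mono hi')).1
      (h hi')

/-- The condition on neighbouring columns passes to distant ones because inclusion of ideals is
transitive. -/
theorem IsPBWSemistandard.exists_le {T : SemiInfTableau p m} (hT : T.IsPBWSemistandard n)
    {i i' : Fin m} (hi : i ≤ i') {j j' : Fin p}
    (hj : T.shift i + (j : ℕ) = T.shift i' + (j' : ℕ)) :
    ∃ j'' : Fin p, j' ≤ j'' ∧ T.content i j ≤ T.content i' j'' := by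
  simpa only [content_eq] using (tupleIdeal_subset_iff (hT.isPBWTuple i) (hT.isPBWTuple i')
    (T.shift_mono hi)).1 (((isPBWSemistandard_iff T).1 hT).2 hi) j j' hj

variable [NeZero n]

theorem columnTuple_val (T : SemiInfTableau p m) (i : Fin m) (j : Fin p) :
    ((T.columnTuple n i j : ℕ) : ℤ) = (T.content i j - 1) % n := by
  have h : (0 : ℤ) < n := by exact_mod_cast Nat.pos_of_ne_zero (NeZero.ne n)
  exact Int.toNat_of_nonneg (Int.emod_nonneg (T.content i j - 1) h.ne')

theorem columnTuple_sub_emod {T : SemiInfTableau p m} (hT : T.IsPBWSemistandard n) (i : Fin m)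
    (j : Fin p) :
    (((T.columnTuple n i j : ℕ) : ℤ) - (T.shift i : ℤ)) % (n : ℤ) + 1 = T.tuple i j := by
  have h1 := (hT.isPBWTuple i).1 j
  rw [columnTuple_val, Int.emod_sub_emod, content_eq]
  rw [show ((T.shift i : ℤ) + T.tuple i j - 1 - T.shift i) = T.tuple i j - 1 by ring,
    Int.emod_eq_of_lt (by omega) (by omega)]
  ring

theorem pbwIdeal_columnTuple (hp : 1 ≤ p) {T : SemiInfTableau p m} (hT : T.IsPBWSemistandard n)
    (i : Fin m) :
    pbwIdeal n p (T.columnTuple n i) (T.shift i) = tupleIdeal n p (T.shift i) (T.tuple i) :=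
  pbwIdeal_eq_tupleIdeal hp (hT.isPBWTuple i) (columnTuple_sub_emod hT i)

theorem bijOn_pbwIdeal (hp : 1 ≤ p) (hpn : p < n) (m : ℕ) :
    Set.BijOn
      (fun (T : SemiInfTableau p m) (i : Fin m) => pbwIdeal n p (T.columnTuple n i) (T.shift i))
      {T | T.IsPBWSemistandard n}
      {J : Fin m → Set (CylPoset n p) |
        Monotone J ∧ ∀ i, (J i).Finite ∧ IsLowerSet (J i)} := by
  refine ⟨?_, ?_, ?_⟩
  · intro T hT
    simp only [Set.mem_ofPred_eq, pbwIdeal_columnTuple hp hT]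
    exact ⟨((isPBWSemistandard_iff T).1 hT).2,
      fun i => ⟨finite_tupleIdeal, isLowerSet_tupleIdeal hpn (hT.isPBWTuple i)⟩⟩
  · intro T hT T' hT' h
    have hi : ∀ i, T.shift i = T'.shift i ∧ T.tuple i = T'.tuple i := by
      intro i
      have := congrFun h i
      simp only [pbwIdeal_columnTuple hp hT, pbwIdeal_columnTuple hp hT'] at this
      exact tupleIdeal_injective hpn (hT.isPBWTuple i) (hT'.isPBWTuple i) this
    refine SemiInfTableau.ext (funext fun i => (hi i).1) (funext fun i => funext fun j => ?_)
    rw [content_eq, content_eq, (hi i).1, (hi i).2]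
  · rintro J ⟨hJ, hJ'⟩
    choose k β hβ h using fun i => exists_tupleIdeal_eq hpn (hJ' i).1 (hJ' i).2
    let T : SemiInfTableau p m := ⟨k, fun i i' hi => shift_le_of_tupleIdeal_subset hpn
      (by rw [h, h]; exact hJ hi), fun i j => k i + β i j⟩
    have hT' : T.tuple = β := by
      funext i j
      simp [T, tuple]
    have hT : T.IsPBWSemistandard n := by
      rw [isPBWSemistandard_iff, hT']
      refine ⟨hβ, ?_⟩
      have : (fun i => tupleIdeal n p (T.shift i) (β i)) = J := funext h
      rwa [this]
    refine ⟨T, hT, funext fun i => ?_⟩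
    simp only [pbwIdeal_columnTuple hp hT, hT']
    exact h i

end SemiInfTableau

section

open Finset MvPolynomial

/-! ### Exponents of strictly least weight. -/

section HasLeastExponent

variable {σ R : Type*} [CommRing R]

/-- Among the exponents of `f`, the exponent `e` is the only one of least weight. -/
def HasLeastExponent (w : σ → ℕ) (f : MvPolynomial σ R) (e : σ →₀ ℕ) : Prop :=
  coeff e f ≠ 0 ∧ ∀ e', coeff e' f ≠ 0 → e' ≠ e → Finsupp.weight w e < Finsupp.weight w e'

variable {w : σ → ℕ} {f g : MvPolynomial σ R} {e e' : σ →₀ ℕ}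

theorem HasLeastExponent.weight_le (h : HasLeastExponent w f e) (he : coeff e' f ≠ 0) :
    Finsupp.weight w e ≤ Finsupp.weight w e' := by
  by_cases h1 : e' = e
  · rw [h1]
  · exact (h.2 e' he h1).le

theorem hasLeastExponent_sum_monomial {ι : Type*} {s : Finset ι} {E : ι → σ →₀ ℕ} {c : ι → R}
    {x₀ : ι} (hx₀ : x₀ ∈ s) (hc : c x₀ ≠ 0)
    (h : ∀ x ∈ s, x ≠ x₀ → Finsupp.weight w (E x₀) < Finsupp.weight w (E x)) :
    HasLeastExponent w (∑ x ∈ s, monomial (E x) (c x)) (E x₀) := by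
  classical
  constructor
  · rw [coeff_sum, sum_eq_single x₀]
    · simpa using hc
    · intro x hx hne
      rw [coeff_monomial, if_neg]
      intro h1
      have := h x hx hne
      rw [h1] at this
      exact lt_irrefl _ this
    · exact fun h1 => absurd hx₀ h1
  · intro e' he' hne
    rw [coeff_sum] at he'
    obtain ⟨x, hx, h1⟩ := exists_ne_zero_of_sum_ne_zero he'
    rw [coeff_monomial] at h1
    have h2 : E x = e' := by
      by_contra h3
      exact h1 (if_neg h3)
    subst h2
    exact h x hx fun h3 => hne (by rw [h3])

variable [IsDomain R]

theorem HasLeastExponent.mul (hf : HasLeastExponent w f e) (hg : HasLeastExponent w g e') :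
    HasLeastExponent w (f * g) (e + e') := by
  classical
  have key : ∀ a b, coeff a f * coeff b g ≠ 0 → ¬ (a = e ∧ b = e') →
      Finsupp.weight w (e + e') < Finsupp.weight w (a + b) := by
    intro a b hab hne
    have ha := left_ne_zero_of_mul hab
    have hb := right_ne_zero_of_mul hab
    rw [map_add, map_add]
    by_cases h1 : a = e
    · have := hg.2 b hb fun h2 => hne ⟨h1, h2⟩
      have := hf.weight_le ha
      omega
    · have := hg.weight_le hb
      have := hf.2 a ha h1
      omega
  constructor
  · rw [coeff_mul, sum_eq_single (e, e')]
    · exact mul_ne_zero hf.1 hg.1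
    · rintro ⟨a, b⟩ hab hne
      by_contra h
      have := key a b h (by simpa using hne)
      rw [HasAntidiagonal.mem_antidiagonal.1 hab] at this
      exact lt_irrefl _ this
    · intro h
      simp at h
  · intro x hx hne
    rw [coeff_mul] at hx
    obtain ⟨⟨a, b⟩, hab, h⟩ := exists_ne_zero_of_sum_ne_zero hx
    rw [HasAntidiagonal.mem_antidiagonal] at hab
    simp only at hab
    subst hab
    refine key a b h ?_
    rintro ⟨rfl, rfl⟩
    exact hne rfl

theorem HasLeastExponent.prod {ι : Type*} (s : Finset ι) {f : ι → MvPolynomial σ R}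
    {e : ι → σ →₀ ℕ} (h : ∀ i ∈ s, HasLeastExponent w (f i) (e i)) :
    HasLeastExponent w (∏ i ∈ s, f i) (∑ i ∈ s, e i) := by
  classical
  induction s using Finset.induction_on with
  | empty =>
    refine ⟨by simp, fun e' he' hne => ?_⟩
    rw [prod_empty, coeff_one] at he'
    simp only [sum_empty] at hne
    simp [Ne.symm hne] at he'
  | insert a s ha ih =>
    rw [prod_insert ha, sum_insert ha]
    exact (h a (mem_insert_self a s)).mul (ih fun i hi => h i (mem_insert_of_mem hi))

/-- In a relation, the lightest leading exponent occurs in no other summand, so its coefficient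
cannot cancel. -/
theorem linearIndependent_of_hasLeastExponent {ι : Type*} {f : ι → MvPolynomial σ R}
    {e : ι → σ →₀ ℕ} (he : Function.Injective e) (h : ∀ i, HasLeastExponent w (f i) (e i)) :
    LinearIndependent R f := by
  rw [linearIndependent_iff]
  intro l hl
  by_contra hne
  obtain ⟨i, hi, hmin⟩ := exists_min_image l.support (fun i => Finsupp.weight w (e i))
    (Finsupp.support_nonempty_iff.2 hne)
  have h1 : coeff (e i) (Finsupp.linearCombination R f l) = l i * coeff (e i) (f i) := by
    rw [Finsupp.linearCombination_apply, Finsupp.sum, coeff_sum, sum_eq_single i]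
    · rw [coeff_smul, smul_eq_mul]
    · intro j hj hji
      rw [coeff_smul]
      by_contra h2
      have h3 : coeff (e i) (f j) ≠ 0 := fun h3 => h2 (by rw [h3, smul_zero])
      have h4 := (h j).2 _ h3 fun h5 => hji (he h5.symm)
      have := hmin j hj
      omega
    · intro h2
      exact absurd hi h2
  rw [hl, coeff_zero] at h1
  exact mul_ne_zero (Finsupp.mem_support_iff.1 hi) (h i).1 h1.symm

end HasLeastExponent

/-! ### Comparison of base-`B` expansions and of sets of heights. -/

section digits

theorem sum_digits_lt_pow {ι : Type*} {s : Finset ι} {a d : ι → ℕ} {B h : ℕ} (hB : 0 < B)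
    (ha : Set.InjOn a s) (hlt : ∀ i ∈ s, a i < h) (hd : ∀ i ∈ s, d i < B) :
    ∑ i ∈ s, d i * B ^ a i < B ^ h := by
  have key : ∀ h : ℕ, 0 < B → ∑ t ∈ range h, (B - 1) * B ^ t < B ^ h := by
    intro h hB
    induction h with
    | zero => simp
    | succ h ih =>
      rw [sum_range_succ, pow_succ]
      obtain ⟨b, rfl⟩ : ∃ b, B = b + 1 := ⟨B - 1, by omega⟩
      simp only [Nat.add_sub_cancel] at ih ⊢
      nlinarith
  refine lt_of_le_of_lt ?_ (key h hB)
  calc ∑ i ∈ s, d i * B ^ a i ≤ ∑ i ∈ s, (B - 1) * B ^ a i :=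
        sum_le_sum fun i hi => Nat.mul_le_mul_right _ (Nat.le_sub_one_of_lt (hd i hi))
    _ = ∑ t ∈ s.image a, (B - 1) * B ^ t := (sum_image (f := fun t => (B - 1) * B ^ t) ha).symm
    _ ≤ ∑ t ∈ range h, (B - 1) * B ^ t := by
        refine sum_le_sum_of_subset fun t ht => ?_
        obtain ⟨i, hi, rfl⟩ := mem_image.1 ht
        exact mem_range.2 (hlt i hi)

theorem sum_digits_lt_sum_digits {p : ℕ} {d d' : Fin p → ℕ} {B k : ℕ} (hd : ∀ i, d i < B)
    (h : Fin p) (hgt : ∀ i, h < i → d i = d' i) (hh : d h < d' h) :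
    ∑ i, d i * B ^ (k + (i : ℕ)) < ∑ i, d' i * B ^ (k + (i : ℕ)) := by
  rw [← sum_filter_add_sum_filter_not univ (fun i => i < h),
    ← sum_filter_add_sum_filter_not (s := univ) (f := fun i => d' i * _) (fun i => i < h)]
  have h1 : ∑ i with i < h, d i * B ^ (k + (i : ℕ)) < B ^ (k + (h : ℕ)) :=
    sum_digits_lt_pow ((Nat.zero_le _).trans_lt (hd h)) (fun i _ j _ hij => Fin.ext (by simpa using hij))
      (fun i hi => by
        have : (i : ℕ) < h := (mem_filter.1 hi).2
        omega) (fun i _ => hd i)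
  have h2 : ∑ i with ¬ i < h, d i * B ^ (k + (i : ℕ)) + B ^ (k + (h : ℕ)) ≤
      ∑ i with ¬ i < h, d' i * B ^ (k + (i : ℕ)) := by
    have hm : h ∈ univ.filter fun i => ¬ i < h := by simp
    rw [← add_sum_erase _ _ hm, ← add_sum_erase _ (fun i => d' i * _) hm]
    have h3 : ∑ i ∈ (univ.filter fun i => ¬ i < h).erase h, d i * B ^ (k + (i : ℕ)) =
        ∑ i ∈ (univ.filter fun i => ¬ i < h).erase h, d' i * B ^ (k + (i : ℕ)) := by
      refine sum_congr rfl fun i hi => ?_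
      rw [hgt i]
      simp only [mem_erase, mem_filter, mem_univ, true_and, not_lt] at hi
      exact lt_of_le_of_ne hi.2 (Ne.symm hi.1)
    rw [h3]
    have : (d h + 1) * B ^ (k + (h : ℕ)) ≤ d' h * B ^ (k + (h : ℕ)) :=
      Nat.mul_le_mul_right _ hh
    rw [add_mul, one_mul] at this
    omega
  omega

/-- The interval `[k, k + p)` has the largest sum among `p`-element sets of naturals below `k + p`;
trading an element of it for one below `k` lowers the sum. -/
theorem le_of_injective_of_sum_eq {p k : ℕ} {a : Fin p → ℕ} (ha : Function.Injective a)
    (hlt : ∀ b, a b < k + p) (hs : ∑ b, a b = ∑ b : Fin p, (k + (b : ℕ))) (b : Fin p) :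
    k ≤ a b := by
  have hA : ∑ x ∈ univ.image a, x = ∑ x ∈ Ico k (k + p), x := by
    rw [sum_image (f := fun x => x) ha.injOn, hs, sum_Ico_eq_sum_range, Nat.add_sub_cancel_left,
      Fin.sum_univ_eq_sum_range (fun x => k + x)]
  have hc : (univ.image a).card = (Ico k (k + p)).card := by
    rw [card_image_of_injective _ ha]
    simp
  have h1 : (univ.image a \ Ico k (k + p)).card = (Ico k (k + p) \ univ.image a).card := by
    rw [card_sdiff_comm hc]
  have h2 : ∑ x ∈ univ.image a \ Ico k (k + p), x = ∑ x ∈ Ico k (k + p) \ univ.image a, x := by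
    have e1 := sum_inter_add_sum_sdiff (univ.image a) (Ico k (k + p)) (fun x => x)
    have e2 := sum_inter_add_sum_sdiff (Ico k (k + p)) (univ.image a) (fun x => x)
    rw [inter_comm] at e2
    omega
  by_contra hb
  have hm : a b ∈ univ.image a \ Ico k (k + p) := by
    simp
    omega
  have h3 : ∑ x ∈ univ.image a \ Ico k (k + p), x <
      ∑ x ∈ univ.image a \ Ico k (k + p), k := by
    refine sum_lt_sum_of_nonempty ⟨_, hm⟩ fun x hx => ?_
    simp only [mem_sdiff, mem_image, mem_univ, true_and, mem_Ico, not_and, not_lt] at hx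
    obtain ⟨⟨c, rfl⟩, hc⟩ := hx
    have := hlt c
    omega
  have h4 : ∑ x ∈ Ico k (k + p) \ univ.image a, k ≤ ∑ x ∈ Ico k (k + p) \ univ.image a, x :=
    sum_le_sum fun x hx => (mem_Ico.1 (mem_sdiff.1 hx).1).1
  simp only [sum_const, h1] at h3 h4
  omega

end digits

/-! ### The leading monomial of a minor. -/

theorem sum_add_div_eq (p k : ℕ) (hp : 0 < p) : ∑ b : Fin p, (k + (b : ℕ)) / p = k := by
  rw [Fin.sum_univ_eq_sum_range (fun b => (k + b) / p)]
  induction k with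
  | zero => exact sum_eq_zero fun b hb => by simpa using Nat.div_eq_of_lt (mem_range.1 hb)
  | succ k ih =>
    have h1 := sum_range_succ (fun b => (k + b) / p) p
    have h2 := sum_range_succ' (fun b => (k + b) / p) p
    have h3 : ∑ b ∈ range p, (k + (b + 1)) / p = ∑ b ∈ range p, (k + 1 + b) / p :=
      sum_congr rfl fun b _ => by rw [add_right_comm, add_assoc]
    rw [h1, ih, h3, Nat.add_div_right _ hp, add_zero] at h2
    omega

theorem arcMinor_eq_sum (n p : ℕ) (I : Fin p → Fin n) (k : ℕ) :
    arcMinor n p I k =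
      ∑ x ∈ (univ : Finset (Equiv.Perm (Fin p))) ×ˢ finsuppAntidiag (univ : Finset (Fin p)) k,
        monomial (∑ b, Finsupp.single ((x.1 b, I b, x.2 b) : ArcVar n p) 1)
          (((Equiv.Perm.sign x.1 : ℤˣ) : ℤ) : ℂ) := by
  rw [arcMinor, Matrix.det_apply, map_sum, sum_product]
  refine sum_congr rfl fun σ _ => ?_
  rw [Units.smul_def, map_zsmul, PowerSeries.coeff_prod, smul_sum]
  refine sum_congr rfl fun l _ => ?_
  have h1 : ∏ b, PowerSeries.coeff (l b)
      (Matrix.of (fun a b : Fin p => arcSeries n p a (I b)) (σ b) b) =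
      monomial (∑ b, Finsupp.single ((σ b, I b, l b) : ArcVar n p) 1) (1 : ℂ) := by
    rw [monomial_sum_one]
    refine prod_congr rfl fun b _ => ?_
    simp only [Matrix.of_apply, arcSeries, PowerSeries.coeff_mk]
    rfl
  rw [h1, zsmul_eq_mul, ← map_intCast (C : ℂ →+* MvPolynomial (ArcVar n p) ℂ), C_mul_monomial,
    mul_one]

/-- The height of the variable `z_{i,j}^{(k)}` in the periodic picture. -/
def arcHeight {n p : ℕ} (v : ArcVar n p) : ℕ := v.1 + p * v.2.2

/-- The distance, modulo `n`, from the height of a variable to its column number. -/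
def arcOffset {n p : ℕ} (v : ArcVar n p) : ℕ :=
  ((((v.2.1 : ℕ) : ℤ) - (arcHeight v : ℤ)) % (n : ℤ)).toNat

/-- The weight of a variable which selects the leading monomials of the minors. -/
def arcCost {n p : ℕ} (v : ArcVar n p) : ℕ := (n + arcOffset v) * (2 * n) ^ arcHeight v

/-- The variable of column number `j` in the row of height `h`. -/
def boxVar {n p : ℕ} [NeZero p] (h : ℕ) (j : Fin n) : ArcVar n p :=
  (⟨h % p, Nat.mod_lt _ (NeZero.pos p)⟩, j, h / p)

theorem arcHeight_boxVar {n p : ℕ} [NeZero p] (h : ℕ) (j : Fin n) :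
    arcHeight (boxVar h j : ArcVar n p) = h := Nat.mod_add_div h p

theorem boxVar_arcHeight {n p : ℕ} [NeZero p] (v : ArcVar n p) :
    boxVar (arcHeight v) v.2.1 = v := by
  obtain ⟨i, j, l⟩ := v
  have hp : 0 < p := NeZero.pos p
  simp only [boxVar, arcHeight, Prod.mk.injEq, Fin.ext_iff, true_and]
  exact ⟨by rw [Nat.add_mul_mod_self_left, Nat.mod_eq_of_lt i.2],
    by rw [Nat.add_mul_div_left _ _ hp, Nat.div_eq_of_lt i.2, zero_add]⟩

theorem weight_sum_single {ι σ M : Type*} [AddCommMonoid M] (w : σ → M) (s : Finset ι)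
    (v : ι → σ) : Finsupp.weight w (∑ i ∈ s, Finsupp.single (v i) (1 : ℕ)) = ∑ i ∈ s, w (v i) := by
  simp [map_sum, Finsupp.weight_single]

section leadingTerm

variable {n p : ℕ} {β : Fin p → ℤ} {k : ℕ} {I : Fin p → Fin n}

theorem arcOffset_lt (hn : 0 < n) (v : ArcVar n p) : arcOffset v < n := by
  have h := Int.emod_lt_of_pos (((v.2.1 : ℕ) : ℤ) - (arcHeight v : ℤ)) (b := (n : ℤ)) (by omega)
  have h' := Int.emod_nonneg (((v.2.1 : ℕ) : ℤ) - (arcHeight v : ℤ)) (b := (n : ℤ)) (by omega)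
  unfold arcOffset
  omega

/-- The offset of a column in the row of height `k + h`. -/
theorem arcOffset_boxVar [NeZero p] (hI : ∀ a, (((I a : ℕ) : ℤ) - (k : ℤ)) % (n : ℤ) + 1 = β a)
    (h b : Fin p) :
    arcOffset (boxVar (k + h) (I b) : ArcVar n p) = ((β b - 1 - (h : ℕ)) % (n : ℤ)).toNat := by
  unfold arcOffset
  rw [arcHeight_boxVar, ← hI b, add_sub_cancel_right, Int.emod_sub_emod]
  push_cast
  rw [← sub_sub]
  rfl

/-- The cost is an expansion in base `2 * n` with the heights as places and digits `n + arcOffset`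
in `[n, 2n)`. Using a height `≥ k + p` is too expensive since no digit is zero. Otherwise the
heights are a permutation of `k, …, k + p - 1`, and the highest place where it is nontrivial
decides. -/
theorem sum_arcCost_lt [NeZero p] (hpn : p < n) (hβ : IsPBWTuple n p β)
    (hI : ∀ a, (((I a : ℕ) : ℤ) - (k : ℤ)) % (n : ℤ) + 1 = β a) {a : Fin p → ℕ}
    (ha : Function.Injective a) (hs : ∑ b, a b = ∑ b : Fin p, (k + (b : ℕ)))
    (hne : ∃ b, a b ≠ k + b) :
    ∑ b : Fin p, arcCost (boxVar (k + b) (I b) : ArcVar n p) <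
      ∑ b, arcCost (boxVar (a b) (I b) : ArcVar n p) := by
  have hn : 0 < n := by omega
  have hd : ∀ v : ArcVar n p, n + arcOffset v < 2 * n := fun v => by
    have := arcOffset_lt hn v
    omega
  simp only [arcCost, arcHeight_boxVar]
  by_cases hlt : ∀ b, a b < k + p
  · have hge := le_of_injective_of_sum_eq ha hlt hs
    let τ : Equiv.Perm (Fin p) := Equiv.ofBijective
      (fun b => (⟨a b - k, by have := hlt b; have := hge b; omega⟩ : Fin p))
      (Finite.injective_iff_bijective.1 fun b c hbc => ha (by
        have := hge b
        have := hge c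
        simp only [Fin.mk.injEq] at hbc
        omega))
    have hτ : ∀ b, a b = k + (τ b : ℕ) := fun b => by
      have := hge b
      simp only [τ, Equiv.ofBijective_apply]
      omega
    have hsum : ∑ b, (n + arcOffset (boxVar (a b) (I b) : ArcVar n p)) * (2 * n) ^ a b =
        ∑ h : Fin p, (n + arcOffset (boxVar (k + h) (I (τ.symm h)) : ArcVar n p)) *
          (2 * n) ^ (k + (h : ℕ)) := by
      rw [← Equiv.sum_comp τ (fun h : Fin p =>
        (n + arcOffset (boxVar (k + h) (I (τ.symm h)) : ArcVar n p)) * (2 * n) ^ (k + (h : ℕ)))]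
      refine sum_congr rfl fun b _ => ?_
      rw [Equiv.symm_apply_apply, ← hτ]
    rw [hsum]
    obtain ⟨b₀, hb₀⟩ := hne
    obtain ⟨h, hh, hmax⟩ := exists_max_image (univ.filter fun h => τ.symm h ≠ h) id
      ⟨τ b₀, by
        simp only [mem_filter, mem_univ, true_and, Equiv.symm_apply_apply]
        intro h1
        exact hb₀ (by rw [hτ, ← h1])⟩
    simp only [mem_filter, mem_univ, true_and, id] at hh hmax
    have hfix : ∀ i, h < i → τ.symm i = i := fun i hi => by
      by_contra h1
      exact absurd (hmax i h1) (not_le.2 hi)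
    have hb : τ.symm h < h := by
      by_contra h1
      have h2 := hfix _ (lt_of_le_of_ne (not_lt.1 h1) (Ne.symm hh))
      exact hh (τ.symm.injective h2)
    refine sum_digits_lt_sum_digits
      (d := fun i => n + arcOffset (boxVar (k + i) (I i) : ArcVar n p))
      (d' := fun i => n + arcOffset (boxVar (k + i) (I (τ.symm i)) : ArcVar n p))
      (fun i => hd _) h (fun i hi => by rw [hfix i hi]) ?_
    rw [arcOffset_boxVar hI, arcOffset_boxVar hI]
    generalize τ.symm h = b at hb
    have hb' : (b : ℕ) < h := hb
    have := h.2
    have h1 := hβ.succ_le h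
    have h2 := hβ.1 h
    have h3 := hβ.1 b
    rw [Int.emod_eq_of_lt (a := β h - 1 - (h : ℕ)) (by omega) (by omega)]
    by_cases h4 : (h : ℕ) + 1 ≤ β b
    · rw [Int.emod_eq_of_lt (by omega) (by omega)]
      by_cases h5 : (p : ℤ) < β b
      · have := hβ.apply_lt_apply hb h5
        omega
      · have := hβ.2.2.1 b (by omega)
        omega
    -- Here the offset wraps around to `β b - 1 - h + n`, which exceeds `β h - 1 - h` since `β h ≤
    -- n`.
    · rw [← Int.add_emod_right, Int.emod_eq_of_lt (by omega) (by omega)]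
      omega
  · push Not at hlt
    obtain ⟨b, hb⟩ := hlt
    calc ∑ b : Fin p, (n + arcOffset (boxVar (k + b) (I b) : ArcVar n p)) *
          (2 * n) ^ (k + (b : ℕ)) < (2 * n) ^ (k + p) :=
          sum_digits_lt_pow (by omega) (fun i _ j _ hij => Fin.ext (by simpa using hij))
            (fun i _ => by omega) (fun i _ => hd _)
      _ ≤ (2 * n) ^ a b := Nat.pow_le_pow_right (by omega) hb
      _ ≤ (n + arcOffset (boxVar (a b) (I b) : ArcVar n p)) * (2 * n) ^ a b :=
          Nat.le_mul_of_pos_left _ (by omega)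
      _ ≤ _ := single_le_sum
          (f := fun b => (n + arcOffset (boxVar (a b) (I b) : ArcVar n p)) * (2 * n) ^ a b)
          (fun i _ => Nat.zero_le _) (mem_univ b)

/-- A term of the minor is a permutation `σ` with degrees `l`. Its heights `σ b + p * l b` are
distinct modulo `p`, and their sum depends only on `k`, so `sum_arcCost_lt` applies to every term
except the one with heights `k + b`. -/
theorem hasLeastExponent_arcMinor [NeZero p] (hpn : p < n) (hβ : IsPBWTuple n p β)
    (hI : ∀ a, (((I a : ℕ) : ℤ) - (k : ℤ)) % (n : ℤ) + 1 = β a) :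
    HasLeastExponent arcCost (arcMinor n p I k)
      (∑ b : Fin p, Finsupp.single (boxVar (k + b) (I b) : ArcVar n p) 1) := by
  have hp : 0 < p := NeZero.pos p
  have hheights : ∀ (σ : Equiv.Perm (Fin p)) (l : Fin p → ℕ),
      ∑ b, ((σ b : ℕ) + p * l b) = ∑ b : Fin p, (b : ℕ) + p * ∑ b, l b := by
    intro σ l
    rw [sum_add_distrib, mul_sum, Equiv.sum_comp σ (fun b : Fin p => (b : ℕ))]
  let σ₀ : Equiv.Perm (Fin p) := Equiv.ofBijective
    (fun b : Fin p => (⟨(k + b) % p, Nat.mod_lt _ hp⟩ : Fin p))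
    (Finite.injective_iff_bijective.1 fun b c hbc => by
      simp only [Fin.mk.injEq] at hbc
      have h1 : (b : ℕ) ≡ c [MOD p] := Nat.ModEq.add_left_cancel' k hbc
      exact Fin.ext (Nat.ModEq.eq_of_lt_of_lt h1 b.2 c.2))
  let l₀ : Fin p →₀ ℕ := Finsupp.equivFunOnFinite.symm fun b => (k + (b : ℕ)) / p
  have h₀ : ∀ b, ((σ₀ b, I b, l₀ b) : ArcVar n p) = boxVar (k + b) (I b) := fun b => rfl
  have hl₀ : ∑ b, l₀ b = k := sum_add_div_eq p k hp
  have hmem : (σ₀, l₀) ∈ (univ : Finset (Equiv.Perm (Fin p))) ×ˢ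
      finsuppAntidiag (univ : Finset (Fin p)) k := by
    simp only [mem_product, mem_univ, true_and, mem_finsuppAntidiag, subset_univ, and_true]
    exact hl₀
  rw [arcMinor_eq_sum]
  have key := hasLeastExponent_sum_monomial (w := arcCost)
    (E := fun x : Equiv.Perm (Fin p) × (Fin p →₀ ℕ) =>
      ∑ b, Finsupp.single ((x.1 b, I b, x.2 b) : ArcVar n p) 1)
    (c := fun x => (((Equiv.Perm.sign x.1 : ℤˣ) : ℤ) : ℂ)) hmem (by
      simp) ?_
  · exact key
  · rintro ⟨σ, l⟩ hx hne
    simp only [mem_product, mem_univ, true_and, mem_finsuppAntidiag, subset_univ, and_true] at hx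
    simp only [weight_sum_single, h₀]
    have hv : ∀ b, ((σ b, I b, l b) : ArcVar n p) = boxVar ((σ b : ℕ) + p * l b) (I b) :=
      fun b => (boxVar_arcHeight ((σ b, I b, l b) : ArcVar n p)).symm
    simp only [hv]
    refine sum_arcCost_lt hpn hβ hI ?_ ?_ ?_
    · intro b c hbc
      have h1 := congrArg (· % p) hbc
      simp only [Nat.add_mul_mod_self_left, Nat.mod_eq_of_lt (Fin.is_lt _)] at h1
      exact σ.injective (Fin.ext h1)
    · have h1 := hheights σ₀ l₀
      rw [hl₀] at h1
      rw [hheights, hx]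
      exact h1.symm.trans <| sum_congr rfl fun b _ => Nat.mod_add_div _ _
    · by_contra hcon
      push Not at hcon
      refine hne ?_
      rw [Prod.mk.injEq]
      constructor
      · refine Equiv.ext fun b => Fin.ext ?_
        show (σ b : ℕ) = (k + b) % p
        rw [← hcon b, Nat.add_mul_mod_self_left, Nat.mod_eq_of_lt (Fin.is_lt _)]
      · refine Finsupp.ext fun b => ?_
        show l b = (k + b) / p
        rw [← hcon b, Nat.add_mul_div_left _ _ hp, Nat.div_eq_of_lt (Fin.is_lt _), zero_add]

end leadingTerm

/-! ### Recovering a tableau from its leading exponent. -/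

namespace SemiInfTableau

variable {n p m : ℕ}

section reconstruction

/-- The boxes of the first columns of two tableaux carry the same contents at the same heights. -/
def SameBoxes (T T' : SemiInfTableau p m) (i : Fin m) : Prop :=
  ∀ H : ℕ → ℤ → ℕ, ∑ i' ∈ Iic i, ∑ b : Fin p, H (T.shift i' + b) (T.content i' b) =
    ∑ i' ∈ Iic i, ∑ b : Fin p, H (T'.shift i' + b) (T'.content i' b)

variable {T T' : SemiInfTableau p m} {i : Fin m}

theorem SameBoxes.symm (h : SameBoxes T T' i) : SameBoxes T' T i := fun H => (h H).symm

theorem SameBoxes.exists_box (h : SameBoxes T T' i) (b : Fin p) :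
    ∃ i' ≤ i, ∃ b' : Fin p, T.shift i' + (b' : ℕ) = T'.shift i + b ∧
      T.content i' b' = T'.content i b := by
  classical
  have h1 := h fun x c => if x = T'.shift i + b ∧ c = T'.content i b then 1 else 0
  have h2 : 0 < ∑ i' ∈ Iic i, ∑ b' : Fin p,
      if T'.shift i' + (b' : ℕ) = T'.shift i + b ∧ T'.content i' b' = T'.content i b
        then 1 else 0 := by
    refine sum_pos' (fun _ _ => Nat.zero_le _) ⟨i, mem_Iic.2 le_rfl, ?_⟩
    exact sum_pos' (fun _ _ => Nat.zero_le _) ⟨b, mem_univ b, by simp⟩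
  rw [← h1] at h2
  obtain ⟨i', hi', h3⟩ := exists_ne_zero_of_sum_ne_zero h2.ne'
  obtain ⟨b', -, h4⟩ := exists_ne_zero_of_sum_ne_zero h3
  refine ⟨i', mem_Iic.1 hi', b', ?_⟩
  by_contra h5
  exact h4 (if_neg h5)

/-- The top box of the last column of `T'` must occur in `T`, where no box is higher than the top of
the last column. -/
theorem SameBoxes.shift_le (h : SameBoxes T T' i) (hp : 1 ≤ p) : T'.shift i ≤ T.shift i := by
  obtain ⟨i', hi', b', h1, -⟩ := h.exists_box ⟨p - 1, by omega⟩
  have h2 := T.shift_mono hi'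
  have h3 := b'.2
  simp only at h1
  omega

/-- The content of the box in `T'` occurs at the same height in some column of `T`, so
semistandardness bounds it by a content of the last column at this height or above. If only a box
above works, decrease of the large entries makes the entry of `T'` small, hence the least value its
position allows. -/
theorem SameBoxes.content_le (h : SameBoxes T T' i) (hT : T.IsPBWSemistandard n)
    (hT' : T'.IsPBWSemistandard n) (hs : T.shift i = T'.shift i) {b : Fin p}
    (hb : ∀ b', b < b' → T.content i b' = T'.content i b') :
    T'.content i b ≤ T.content i b := by
  by_contra hlt
  obtain ⟨i', hi', b₁, h1, h2⟩ := h.exists_box b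
  obtain ⟨b₂, h3, h4⟩ := hT.exists_le hi' (j' := b) (h1.trans (by rw [hs]))
  rcases h3.eq_or_lt with rfl | h3
  · omega
  · rw [h2, hb b₂ h3] at h4
    have hβ' := hT'.isPBWTuple i
    rw [content_eq, content_eq] at h4
    have h5 : ¬ (p : ℤ) < T'.tuple i b := fun h5 => by
      have := hβ'.apply_lt_apply h3 h5
      omega
    have h6 := hβ'.2.2.1 b (by omega)
    have h7 := (hT.isPBWTuple i).succ_le b
    rw [content_eq, content_eq, h6, hs] at hlt
    omega

theorem SameBoxes.content_eq (h : SameBoxes T T' i) (hT : T.IsPBWSemistandard n)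
    (hT' : T'.IsPBWSemistandard n) (hs : T.shift i = T'.shift i) :
    T.content i = T'.content i := by
  by_contra hne
  obtain ⟨b₀, hb₀⟩ := Function.ne_iff.1 hne
  obtain ⟨b, hb, hmax⟩ := exists_max_image (univ.filter fun b => T.content i b ≠ T'.content i b) id
    ⟨b₀, by simpa using hb₀⟩
  simp only [mem_filter, mem_univ, true_and, id] at hb hmax
  have hb' : ∀ b', b < b' → T.content i b' = T'.content i b' := fun b' hlt => by
    by_contra h1
    exact absurd (hmax b' h1) (not_le.2 hlt)
  exact hb (le_antisymm (h.symm.content_le hT' hT hs.symm fun b' hlt => (hb' b' hlt).symm)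
    (h.content_le hT hT' hs hb'))

/-- At the last column where the tableaux differ, the columns up to it still carry the same boxes;
the two one-sided comparisons then force equality there. -/
theorem eq_of_sum_eq (hp : 1 ≤ p) (hT : T.IsPBWSemistandard n) (hT' : T'.IsPBWSemistandard n)
    (h : ∀ H : ℕ → ℤ → ℕ, ∑ i, ∑ b : Fin p, H (T.shift i + b) (T.content i b) =
      ∑ i, ∑ b : Fin p, H (T'.shift i + b) (T'.content i b)) : T = T' := by
  have key : ∀ i, T.shift i = T'.shift i ∧ T.content i = T'.content i := by
    by_contra hne
    push Not at hne
    obtain ⟨i₀, hi₀⟩ := hne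
    obtain ⟨i, hi, hmax⟩ := exists_max_image
      (univ.filter fun i => ¬ (T.shift i = T'.shift i ∧ T.content i = T'.content i)) id
      ⟨i₀, by simpa using hi₀⟩
    simp only [mem_filter, mem_univ, true_and, id] at hi hmax
    have hsame : SameBoxes T T' i := by
      intro H
      have h1 := h H
      rw [← sum_filter_add_sum_filter_not univ (fun i' => i' ≤ i),
        ← sum_filter_add_sum_filter_not (s := univ)
          (f := fun i' => ∑ b : Fin p, H (T'.shift i' + b) (T'.content i' b)) (fun i' => i' ≤ i)]
        at h1
      have h2 : ∑ i' with ¬ i' ≤ i, ∑ b : Fin p, H (T.shift i' + b) (T.content i' b) =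
          ∑ i' with ¬ i' ≤ i, ∑ b : Fin p, H (T'.shift i' + b) (T'.content i' b) := by
        refine sum_congr rfl fun i' hi' => ?_
        have h3 : T.shift i' = T'.shift i' ∧ T.content i' = T'.content i' := by
          by_contra h3
          exact (mem_filter.1 hi').2 (hmax i' h3)
        rw [h3.1, h3.2]
      have h4 : (Iic i : Finset (Fin m)) = univ.filter fun i' => i' ≤ i := by
        ext
        simp
      rw [h4]
      omega
    have hs := le_antisymm (hsame.symm.shift_le hp) (hsame.shift_le hp)
    exact hi ⟨hs, hsame.content_eq hT hT' hs⟩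
  exact SemiInfTableau.ext (funext fun i => (key i).1) (funext fun i => (key i).2)

end reconstruction

variable [NeZero n] [NeZero p]

/-- The exponent of the leading monomial of the product attached to a tableau. -/
noncomputable def leadingExponent (n : ℕ) [NeZero n] (T : SemiInfTableau p m) :
    ArcVar n p →₀ ℕ :=
  ∑ i, ∑ b : Fin p, Finsupp.single (boxVar (T.shift i + b) (T.columnTuple n i b)) 1

theorem weight_leadingExponent {M : Type*} [AddCommMonoid M] (w : ArcVar n p → M)
    (T : SemiInfTableau p m) : Finsupp.weight w (T.leadingExponent n) =
      ∑ i, ∑ b : Fin p, w (boxVar (T.shift i + b) (T.columnTuple n i b)) := by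
  simp only [leadingExponent, map_sum, Finsupp.weight_single, one_smul]

theorem hasLeastExponent_minorProduct (hpn : p < n) {T : SemiInfTableau p m}
    (hT : T.IsPBWSemistandard n) :
    HasLeastExponent arcCost (T.minorProduct n) (T.leadingExponent n) :=
  HasLeastExponent.prod _ fun i _ =>
    hasLeastExponent_arcMinor hpn (hT.isPBWTuple i) (columnTuple_sub_emod hT i)

/-- The variable remembers the content itself, not just its residue: a content exceeds its height by
less than `n`. -/
theorem arcOffset_boxVar_columnTuple {T : SemiInfTableau p m} (hT : T.IsPBWSemistandard n)
    (i : Fin m) (b : Fin p) :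
    ((T.shift i + (b : ℕ) : ℕ) : ℤ) + 1 +
      arcOffset (boxVar (T.shift i + b) (T.columnTuple n i b) : ArcVar n p) = T.content i b := by
  have h1 := (hT.isPBWTuple i).1 b
  have h2 := (hT.isPBWTuple i).succ_le b
  rw [arcOffset_boxVar (columnTuple_sub_emod hT i), Int.emod_eq_of_lt (by omega) (by omega),
    content_eq]
  omega

theorem leadingExponent_injective :
    Function.Injective fun x : Σ m : ℕ, {T : SemiInfTableau p m // T.IsPBWSemistandard n} =>
      x.2.1.leadingExponent n := by
  have hp : 1 ≤ p := NeZero.one_le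
  rintro ⟨m, T, hT⟩ ⟨m', T', hT'⟩ h
  simp only at h
  have hm : m = m' := by
    have h1 := congrArg (Finsupp.weight fun _ => (1 : ℕ)) h
    simp only [weight_leadingExponent, sum_const, card_univ, Fintype.card_fin, smul_eq_mul,
      mul_one] at h1
    exact Nat.eq_of_mul_eq_mul_right hp h1
  subst hm
  have hTT : T = T' := by
    refine eq_of_sum_eq hp hT hT' fun H => ?_
    have h1 := congrArg (Finsupp.weight fun v : ArcVar n p =>
      H (arcHeight v) ((arcHeight v : ℤ) + 1 + arcOffset v)) h
    simpa only [weight_leadingExponent, arcHeight_boxVar, arcOffset_boxVar_columnTuple hT,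
      arcOffset_boxVar_columnTuple hT'] using h1
  subst hTT
  rfl

theorem linearIndependent_minorProduct (hpn : p < n) :
    LinearIndependent ℂ fun x : Σ m : ℕ, {T : SemiInfTableau p m // T.IsPBWSemistandard n} =>
      x.2.1.minorProduct n :=
  linearIndependent_of_hasLeastExponent (w := arcCost) leadingExponent_injective
    fun x => hasLeastExponent_minorProduct hpn x.2.2

end SemiInfTableau

/-! ### Row shears and the monomials of invariant polynomials. -/

section exchange

/-- `A` takes the largest members of the joint multiset, so another choice of as many members with
no smaller sum has the same values. -/
theorem sum_eq_sum_of_exchange {ι : Type*} {A A' B B' : Finset ι} {a a' b b' : ι → ℕ} {θ : ℕ}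
    (hK : ∀ K : ℕ → ℤ, ∑ i ∈ A', K (a' i) + ∑ i ∈ B', K (b' i) =
      ∑ i ∈ A, K (a i) + ∑ i ∈ B, K (b i))
    (hc : A'.card = A.card) (hA : ∀ i ∈ A, θ ≤ a i) (hB : ∀ i ∈ B, b i ≤ θ)
    (hle : ∑ i ∈ A, (a i : ℤ) ≤ ∑ i ∈ A', (a' i : ℤ)) (K : ℕ → ℤ) :
    ∑ i ∈ A', K (a' i) = ∑ i ∈ A, K (a i) := by
  -- The total excess over `θ` is attained by `A` alone; equality forces `A'` above and `B'` below
  -- `θ`.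
  let K₁ : ℕ → ℤ := fun c => max ((c : ℤ) - θ) 0
  have h1 := hK K₁
  have h2 : ∑ i ∈ A, K₁ (a i) = ∑ i ∈ A, ((a i : ℤ) - θ) :=
    sum_congr rfl fun i hi => max_eq_left (by have := hA i hi; omega)
  have h3 : ∑ i ∈ B, K₁ (b i) = 0 :=
    sum_eq_zero fun i hi => max_eq_right (by have := hB i hi; omega)
  have h4 : ∑ i ∈ A', (K₁ (a' i) - ((a' i : ℤ) - θ)) + ∑ i ∈ B', K₁ (b' i) ≤ 0 := by
    rw [sum_sub_distrib]
    rw [h2, h3] at h1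
    simp only [sum_sub_distrib, sum_const, hc] at h1 ⊢
    linarith
  have h5 : ∀ i ∈ A', 0 ≤ K₁ (a' i) - ((a' i : ℤ) - θ) := fun i _ =>
    sub_nonneg.2 (le_max_left _ _)
  have h6 : ∀ i ∈ B', 0 ≤ K₁ (b' i) := fun i _ => le_max_right _ _
  have h7 := sum_nonneg h5
  have h8 := sum_nonneg h6
  have hA' : ∀ i ∈ A', θ ≤ a' i := fun i hi => by
    have h9 := (sum_eq_zero_iff_of_nonneg h5).1 (by linarith) i hi
    have h10 : (0 : ℤ) ≤ K₁ (a' i) := le_max_right _ _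
    omega
  have hB' : ∀ i ∈ B', b' i ≤ θ := fun i hi => by
    have h9 := (sum_eq_zero_iff_of_nonneg h6).1 (by linarith) i hi
    have h10 : ((b' i : ℕ) : ℤ) - θ ≤ K₁ (b' i) := le_max_left _ _
    omega
  -- This test function vanishes up to `θ`, so it isolates `A` and `A'`.
  let K₂ : ℕ → ℤ := fun c => if θ < c then K c - K θ else 0
  have hK₂ : ∀ c, θ ≤ c → K₂ c = K c - K θ := fun c hc => by
    rcases hc.eq_or_lt with rfl | hc
    · simp [K₂]
    · simp [K₂, hc]
  have h11 := hK K₂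
  rw [sum_congr rfl fun i hi => hK₂ _ (hA i hi), sum_congr rfl fun i hi => hK₂ _ (hA' i hi),
    sum_eq_zero (s := B) fun i hi => if_neg (not_lt.2 (hB i hi)),
    sum_eq_zero (s := B') fun i hi => if_neg (not_lt.2 (hB' i hi))] at h11
  simp only [sum_sub_distrib, sum_const, hc] at h11
  linarith

end exchange

section expansion

variable {σ τ ι : Type*} [Fintype ι] [DecidableEq ι]

/-- The exponents which occur when each variable of a monomial is replaced by a binomial. -/
noncomputable def binomialExponent (u q : σ → τ) (v : ι → σ) (S : Finset ι) : τ →₀ ℕ :=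
  ∑ i ∈ S, Finsupp.single (u (v i)) 1 + ∑ i ∈ Sᶜ, Finsupp.single (q (v i)) 1

theorem aeval_binomial_monomial (u q : σ → τ) (c : σ → ℂ) (v : ι → σ) :
    aeval (fun x => (X (u x) + C (c x) * X (q x) : MvPolynomial τ ℂ))
        (monomial (∑ i, Finsupp.single (v i) 1) (1 : ℂ)) =
      ∑ S : Finset ι, monomial (binomialExponent u q v S) (∏ i ∈ Sᶜ, c (v i)) := by
  rw [monomial_sum_one, map_prod]
  have h : ∀ i, aeval (fun x => (X (u x) + C (c x) * X (q x) : MvPolynomial τ ℂ))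
      (monomial (Finsupp.single (v i) 1) (1 : ℂ)) = X (u (v i)) + C (c (v i)) * X (q (v i)) :=
    fun i => aeval_X _ _
  simp only [h]
  rw [prod_add, powerset_univ]
  refine sum_congr rfl fun S _ => ?_
  rw [binomialExponent, ← compl_eq_univ_sdiff, prod_mul_distrib, ← map_prod C,
    ← mul_one (∏ i ∈ Sᶜ, c (v i)), ← C_mul_monomial, mul_left_comm, mul_one]
  congr 1
  rw [← one_mul (1 : ℂ), ← monomial_mul, monomial_sum_one, monomial_sum_one]
  rfl

theorem weight_binomialExponent {M : Type*} [AddCommMonoid M] (w : τ → M) (u q : σ → τ)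
    (v : ι → σ) (S : Finset ι) : Finsupp.weight w (binomialExponent u q v S) =
      ∑ i ∈ S, w (u (v i)) + ∑ i ∈ Sᶜ, w (q (v i)) := by
  rw [binomialExponent, map_add, weight_sum_single, weight_sum_single]

theorem coeff_aeval (φ : σ → MvPolynomial τ ℂ) (f : MvPolynomial σ ℂ) (t : τ →₀ ℕ) :
    coeff t (aeval φ f) = ∑ e ∈ f.support, coeff e f * coeff t (aeval φ (monomial e (1 : ℂ))) := by
  conv_lhs => rw [f.as_sum]
  rw [map_sum, coeff_sum]
  refine sum_congr rfl fun e _ => ?_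
  rw [← coeff_C_mul, ← algebraMap_eq, ← Algebra.smul_def, ← map_smul, smul_monomial, smul_eq_mul,
    mul_one]

end expansion

section shear

variable {n p m : ℕ}

/-- The column of a variable, its degree included. -/
def arcColumn {n p : ℕ} (v : ArcVar n p) : ℕ := v.2.1 + n * v.2.2

/-- The variable of the row `r'` which is subtracted from the variable `v` of another row. -/
def shearPartner (r' : Fin p) (ε : ℕ) (v : ArcVar n p) : ArcVar n p := (r', v.2.1, v.2.2 - ε)

theorem arcColumn_shearPartner (r' : Fin p) {ε : ℕ} {v : ArcVar n p} (h : ε ≤ v.2.2) :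
    arcColumn (shearPartner r' ε v) + ε * n = arcColumn v := by
  obtain ⟨i, j, l⟩ := v
  obtain ⟨t, rfl⟩ := Nat.exists_eq_add_of_le h
  simp only [arcColumn, shearPartner, Nat.add_sub_cancel_left]
  ring

/-- The substitution which subtracts `t ^ ε` times the row `r'` of the matrix `Z(t)` from its
row `r`. -/
noncomputable def arcShear (r r' : Fin p) (ε : ℕ) :
    MvPolynomial (ArcVar n p) ℂ →ₐ[ℂ] MvPolynomial (ArcVar n p) ℂ :=
  aeval fun v => X v - if v.1 = r ∧ ε ≤ v.2.2 then X (shearPartner r' ε v) else 0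

/-- On the matrix of power series the shear is an elementary row operation, which preserves the
determinant. -/
theorem arcShear_arcMinor {r r' : Fin p} (hr : r ≠ r') (ε : ℕ) (I : Fin p → Fin n) (k : ℕ) :
    arcShear r r' ε (arcMinor n p I k) = arcMinor n p I k := by
  have h1 : ∀ i j, PowerSeries.map (arcShear r r' ε).toRingHom (arcSeries n p i j) =
      if i = r then arcSeries n p i j - PowerSeries.X ^ ε * arcSeries n p r' j
      else arcSeries n p i j := by
    intro i j
    ext1 l
    split_ifs with hi
    · subst hi
      simp only [PowerSeries.coeff_map, arcSeries, PowerSeries.coeff_mk, map_sub,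
        PowerSeries.coeff_X_pow_mul']
      simp [arcShear, shearPartner]
    · simp [PowerSeries.coeff_map, arcSeries, PowerSeries.coeff_mk, arcShear, hi]
  have h2 : (PowerSeries.map (arcShear r r' ε).toRingHom).mapMatrix
      (Matrix.of fun a b : Fin p => arcSeries n p a (I b)) =
      (Matrix.of fun a b : Fin p => arcSeries n p a (I b)).updateRow r
        ((Matrix.of fun a b : Fin p => arcSeries n p a (I b)) r +
          (-PowerSeries.X ^ ε : PowerSeries (MvPolynomial (ArcVar n p) ℂ)) •
            (Matrix.of fun a b : Fin p => arcSeries n p a (I b)) r') := by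
    ext1 a b
    simp only [RingHom.mapMatrix_apply, Matrix.map_apply, Matrix.of_apply, h1, Matrix.updateRow_apply]
    split_ifs with ha
    · subst ha
      simp [sub_eq_add_neg]
    · rfl
  have h3 := RingHom.map_det (PowerSeries.map (arcShear r r' ε).toRingHom)
    (Matrix.of fun a b : Fin p => arcSeries n p a (I b))
  rw [h2, Matrix.det_updateRow_add_smul_self _ hr] at h3
  have h4 := congrArg (PowerSeries.coeff k) h3
  rw [PowerSeries.coeff_map] at h4
  exact h4

/-- The second term of the binomial that replaces a variable before the shear. -/
def splitVar (r r' : Fin p) (ε : ℕ) (v : ArcVar n p) : ArcVar n p ⊕ ArcVar n p :=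
  if v.1 = r then Sum.inl (shearPartner r' ε v) else Sum.inr v

/-- The coefficient of the second term of the binomial that replaces a variable. -/
def splitCoeff (r r' : Fin p) (ε : ℕ) (v : ArcVar n p) : ℕ :=
  if (v.1 = r ∧ ε ≤ v.2.2) ∨ v.1 = r' then 1 else 0

/-- The second term of the binomial that replaces a variable after the shear. -/
def shearedVar (r r' : Fin p) (ε : ℕ) (v : ArcVar n p) : ArcVar n p :=
  if v.1 = r then shearPartner r' ε v else v

/-- Two copies of the variables polarize the invariance. The left binomials have nonnegative
coefficients. After the shear the partners in the first copy cancel, so there a row `r'` variable of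
the first copy can only come from row `r'`. -/
theorem aeval_split_eq {r r' : Fin p} (hr : r ≠ r') (ε : ℕ) {f : MvPolynomial (ArcVar n p) ℂ}
    (hf : arcShear r r' ε f = f) :
    aeval (fun v => (X (Sum.inl v) + C ((splitCoeff r r' ε v : ℕ) : ℂ) * X (splitVar r r' ε v) :
      MvPolynomial (ArcVar n p ⊕ ArcVar n p) ℂ)) f =
    aeval (fun v => (X (Sum.inl v) + C (if v.1 = r then -(splitCoeff r r' ε v : ℂ) else
      (splitCoeff r r' ε v : ℂ)) * X (Sum.inr (shearedVar r r' ε v)) :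
      MvPolynomial (ArcVar n p ⊕ ArcVar n p) ℂ)) f := by
  conv_lhs => rw [← hf]
  rw [arcShear, ← AlgHom.comp_apply]
  refine DFunLike.congr_fun (MvPolynomial.algHom_ext fun v => ?_) f
  rw [AlgHom.comp_apply, aeval_X, aeval_X, map_sub, aeval_X]
  by_cases h1 : v.1 = r
  · have h2 : v.1 ≠ r' := fun h => hr (h1.symm.trans h)
    by_cases h3 : ε ≤ v.2.2
    · simp [h1, h3, splitCoeff, splitVar, shearedVar, shearPartner, hr, hr.symm]
      ring
    · simp [h1, h3, splitCoeff, hr]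
  · simp [h1, splitVar, shearedVar]

variable [NeZero n]

/-- The variable in the row `r` and the column `c`, the quotient `c / n` being its degree. -/
def rowVar (r : Fin p) (c : ℕ) : ArcVar n p :=
  (r, ⟨c % n, Nat.mod_lt _ (NeZero.pos n)⟩, c / n)

theorem arcColumn_rowVar (r : Fin p) (c : ℕ) : arcColumn (rowVar r c : ArcVar n p) = c :=
  Nat.mod_add_div c n

theorem rowVar_arcColumn (v : ArcVar n p) : rowVar v.1 (arcColumn v) = v := by
  obtain ⟨i, j, l⟩ := v
  have hn : 0 < n := NeZero.pos n
  simp only [rowVar, arcColumn, Prod.mk.injEq, Fin.ext_iff, true_and]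
  exact ⟨by rw [Nat.add_mul_mod_self_left, Nat.mod_eq_of_lt j.2],
    by rw [Nat.add_mul_div_left _ _ hn, Nat.div_eq_of_lt j.2, zero_add]⟩

/-- The exponent of the monomial with the variables in the rows `r` and columns `g r s`. -/
noncomputable def gridExponent (g : Fin p → Fin m → ℕ) : ArcVar n p →₀ ℕ :=
  ∑ x : Fin p × Fin m, Finsupp.single (rowVar x.1 (g x.1 x.2)) 1

theorem card_row (r : Fin p) (q : Fin m → Prop) [DecidablePred q] :
    (univ.filter fun x : Fin p × Fin m => x.1 = r ∧ q x.2).card = (univ.filter q).card := by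
  rw [← card_map (s := univ.filter q) ⟨fun s => (r, s), fun s s' h => (Prod.mk.inj h).2⟩]
  refine congrArg card (Finset.ext fun ⟨a, b⟩ => ?_)
  simp only [mem_filter, mem_univ, true_and, mem_map]
  constructor
  · rintro ⟨rfl, h⟩
    exact ⟨b, h, rfl⟩
  · rintro ⟨c, h, he⟩
    obtain ⟨rfl, rfl⟩ := Prod.mk.inj he
    exact ⟨rfl, h⟩

end shear

section splitWeight

variable {n p : ℕ} {ι : Type*} [Fintype ι] [DecidableEq ι] {r r' : Fin p} {ε : ℕ}

theorem weight_split_elim_self (H : ArcVar n p → ℤ) (v : ι → ArcVar n p) (S : Finset ι) :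
    Finsupp.weight (Sum.elim H H) (binomialExponent Sum.inl (splitVar r r' ε) v S) =
      ∑ i, H (v i) - ∑ i ∈ Sᶜ with (v i).1 = r, (H (v i) - H (shearPartner r' ε (v i))) := by
  rw [weight_binomialExponent, sum_filter, ← sum_add_sum_compl S fun i => H (v i), add_sub_assoc,
    ← sum_sub_distrib]
  refine congrArg₂ _ rfl (sum_congr rfl fun i _ => ?_)
  by_cases h : (v i).1 = r <;> simp [splitVar, h]

theorem weight_split_column (K : ℕ → ℤ) (v : ι → ArcVar n p) (S : Finset ι)
    (hS : ∀ i ∈ Sᶜ, (v i).1 = r → ε ≤ (v i).2.2) :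
    Finsupp.weight (Sum.elim (fun x => if x.1 = r' then K (arcColumn x + ε * n) else 0) 0)
        (binomialExponent Sum.inl (splitVar r r' ε) v S) =
      ∑ i ∈ Sᶜ with (v i).1 = r, K (arcColumn (v i)) +
        ∑ i ∈ S with (v i).1 = r', K (arcColumn (v i) + ε * n) := by
  rw [weight_binomialExponent, sum_filter, sum_filter, add_comm]
  refine congrArg₂ _ (sum_congr rfl fun i hi => ?_) rfl
  by_cases h : (v i).1 = r
  · simp only [splitVar, h, if_true, Sum.elim_inl, ← arcColumn_shearPartner r' (hS i hi h)]
    simp [shearPartner]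
  · simp [splitVar, h]

theorem weight_split_card (hr : r ≠ r') (v : ι → ArcVar n p) (S : Finset ι) :
    Finsupp.weight (Sum.elim (fun x => if x.1 = r then 1 else 0) 0)
        (binomialExponent Sum.inl (splitVar r r' ε) v S) = (S.filter fun i => (v i).1 = r).card := by
  rw [weight_binomialExponent, card_filter, sum_eq_zero (s := Sᶜ), add_zero]
  · rfl
  · intro i _
    by_cases h : (v i).1 = r
    · simp [splitVar, h, shearPartner, hr.symm]
    · simp [splitVar, h]

end splitWeight

theorem Finsupp.eq_of_weight_eq {σ : Type*} {e e' : σ →₀ ℕ}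
    (h : ∀ H : σ → ℤ, Finsupp.weight H e = Finsupp.weight H e') : e = e' := by
  classical
  ext x
  have := h (Pi.single x 1)
  simpa [Finsupp.weight_single_index] using this

section

variable {n p m : ℕ} [NeZero n] {r r' : Fin p} {ε : ℕ}

/-- Moving a variable of column `c` from row `r` to row `r'` lowers `w` by `κ - l * c`. As equally
many variables are moved, maximality of `w` bounds the sum of the moved columns from below, and the
exchange lemma identifies them. -/
theorem eq_gridExponent_of_split_eq (hr : r ≠ r') {w : ArcVar n p → ℤ} {κ l : ℤ} (hl : 0 < l)
    (hw : ∀ v, v.1 = r → ε ≤ v.2.2 → w v - w (shearPartner r' ε v) = κ - l * arcColumn v)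
    {v v' : Fin p × Fin m → ArcVar n p} (hv : ∀ x, (v x).1 = x.1) (hv' : ∀ x, (v' x).1 = x.1)
    {S S' : Finset (Fin p × Fin m)}
    (hS : ∀ i ∈ Sᶜ, (v i).1 = r → ε ≤ (v i).2.2)
    (hS' : ∀ i ∈ S'ᶜ, (v' i).1 = r → ε ≤ (v' i).2.2) {θ : ℕ}
    (hA : ∀ i ∈ Sᶜ, (v i).1 = r → θ ≤ arcColumn (v i))
    (hB : ∀ i ∈ S, (v i).1 = r' → arcColumn (v i) + ε * n ≤ θ)
    (hmax : ∑ i, w (v' i) ≤ ∑ i, w (v i))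
    (hT : binomialExponent Sum.inl (splitVar r r' ε) v' S' =
      binomialExponent Sum.inl (splitVar r r' ε) v S) :
    ∑ i, Finsupp.single (v' i) 1 = ∑ i, Finsupp.single (v i) (1 : ℕ) := by
  have hcard : (S'ᶜ.filter fun i => (v' i).1 = r).card =
      (Sᶜ.filter fun i => (v i).1 = r).card := by
    have h1 := congrArg (Finsupp.weight (Sum.elim (fun x => if x.1 = r then 1 else 0) 0)) hT
    rw [weight_split_card hr, weight_split_card hr] at h1
    simp only [hv, hv'] at h1 ⊢
    have h2 : ∀ R : Finset (Fin p × Fin m), (R.filter fun i => i.1 = r).card +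
        (Rᶜ.filter fun i => i.1 = r).card = (univ.filter fun i : Fin p × Fin m => i.1 = r).card := by
      intro R
      simp only [card_filter]
      exact sum_add_sum_compl R _
    have h3 := h2 S
    have h4 := h2 S'
    omega
  -- Forgetting the copies leaves the original exponent with the moved variables replaced by their
  -- partners.
  have hstar : ∀ H : ArcVar n p → ℤ, _ := fun H =>
    congrArg (Finsupp.weight (Sum.elim H H)) hT
  simp only [weight_split_elim_self] at hstar
  have hK : ∀ K : ℕ → ℤ, _ := fun K => congrArg (Finsupp.weight
    (Sum.elim (fun x => if x.1 = r' then K (arcColumn x + ε * n) else 0) 0)) hT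
  simp only [weight_split_column _ _ _ hS, weight_split_column _ _ _ hS'] at hK
  have hle : ∑ i ∈ Sᶜ with (v i).1 = r, (arcColumn (v i) : ℤ) ≤
      ∑ i ∈ S'ᶜ with (v' i).1 = r, (arcColumn (v' i) : ℤ) := by
    have h1 := hstar w
    rw [sum_congr rfl fun i hi => hw _ (mem_filter.1 hi).2 (hS i (mem_filter.1 hi).1
      (mem_filter.1 hi).2), sum_congr rfl fun i hi => hw _ (mem_filter.1 hi).2
      (hS' i (mem_filter.1 hi).1 (mem_filter.1 hi).2)] at h1
    simp only [sum_sub_distrib, sum_const, hcard, ← mul_sum] at h1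
    have h2 : l * ∑ i ∈ Sᶜ with (v i).1 = r, (arcColumn (v i) : ℤ) ≤
      l * ∑ i ∈ S'ᶜ with (v' i).1 = r, (arcColumn (v' i) : ℤ) := by linarith
    exact le_of_mul_le_mul_left h2 hl
  have hex := sum_eq_sum_of_exchange hK hcard (fun i hi => hA i (mem_filter.1 hi).1
    (mem_filter.1 hi).2) (fun i hi => hB i (mem_filter.1 hi).1 (mem_filter.1 hi).2) hle
  refine Finsupp.eq_of_weight_eq fun H => ?_
  have hδ : ∀ x : ArcVar n p, x.1 = r → H x - H (shearPartner r' ε x) =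
      (fun c => H (rowVar r c) - H (shearPartner r' ε (rowVar r c))) (arcColumn x) := by
    rintro x rfl
    simp only [rowVar_arcColumn]
  have h1 := hstar H
  rw [sum_congr rfl fun i hi => hδ _ (mem_filter.1 hi).2,
    sum_congr rfl fun i hi => hδ _ (mem_filter.1 hi).2,
    hex fun c => H (rowVar r c) - H (shearPartner r' ε (rowVar r c))] at h1
  rw [weight_sum_single, weight_sum_single]
  linarith

/-- If the inequality fails at `s`, moving the row `r` variables from index `s` on produces a
monomial with `m + 1` variables of row `r'` in the first copy. It occurs before the shear with
nonzero coefficient but cannot occur after it. -/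
theorem lt_of_mem_support_of_isMax (hr : r ≠ r') {f : MvPolynomial (ArcVar n p) ℂ}
    (hf : arcShear r r' ε f = f)
    (hsupp : ∀ e ∈ f.support, ∃ g : Fin p → Fin m → ℕ, e = gridExponent g)
    {w : ArcVar n p → ℤ} {κ l : ℤ} (hl : 0 < l)
    (hw : ∀ v, v.1 = r → ε ≤ v.2.2 → w v - w (shearPartner r' ε v) = κ - l * arcColumn v)
    {g : Fin p → Fin m → ℕ} (hg : gridExponent g ∈ f.support)
    (hmax : ∀ e ∈ f.support, Finsupp.weight w e ≤ Finsupp.weight w (gridExponent g))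
    (hm : Monotone (g r)) (hm' : Monotone (g r')) (s : Fin m) : g r s < g r' s + ε * n := by
  classical
  by_contra hlt
  rw [not_lt] at hlt
  let v : (Fin p → Fin m → ℕ) → Fin p × Fin m → ArcVar n p := fun g x => rowVar x.1 (g x.1 x.2)
  -- The complement takes the second term of the binomial: row `r` from `s` on, row `r'` after `s`.
  let S : Finset (Fin p × Fin m) :=
    univ.filter fun x => (x.1 = r → x.2 < s) ∧ (x.1 = r' → x.2 ≤ s)
  have hn : 0 < n := NeZero.pos n
  have hSr : ∀ x ∈ Sᶜ, x.1 = r → s ≤ x.2 := by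
    intro x hx h1
    by_contra h2
    rw [mem_compl] at hx
    refine hx (mem_filter.2 ⟨mem_univ _, fun _ => not_le.1 h2, fun h3 => absurd (h1.symm.trans h3) hr⟩)
  have hSc : ∀ x ∈ Sᶜ, x.1 = r ∨ x.1 = r' := by
    intro x hx
    by_contra h2
    rw [not_or] at h2
    rw [mem_compl] at hx
    exact hx (mem_filter.2 ⟨mem_univ _, fun h3 => absurd h3 h2.1, fun h3 => absurd h3 h2.2⟩)
  have hSε : ∀ x ∈ Sᶜ, (v g x).1 = r → ε ≤ (v g x).2.2 := by
    intro x hx h1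
    have h1' : x.1 = r := h1
    show ε ≤ g x.1 x.2 / n
    rw [h1', Nat.le_div_iff_mul_le hn]
    exact (Nat.le_add_left _ _).trans (hlt.trans (hm (hSr x hx h1)))
  let t := binomialExponent Sum.inl (splitVar r r' ε) (v g) S
  have hexp : ∀ g', gridExponent g' = ∑ x, Finsupp.single (v g' x) 1 := fun _ => rfl
  have hR : ∀ g' : Fin p → Fin m → ℕ, coeff t (aeval (fun v => (X (Sum.inl v) + C (if v.1 = r then
      -(splitCoeff r r' ε v : ℂ) else (splitCoeff r r' ε v : ℂ)) *
        X (Sum.inr (shearedVar r r' ε v)) : MvPolynomial (ArcVar n p ⊕ ArcVar n p) ℂ))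
        (monomial (gridExponent g') (1 : ℂ))) = 0 := by
    intro g'
    rw [hexp, aeval_binomial_monomial Sum.inl (fun v => Sum.inr (shearedVar r r' ε v)), coeff_sum]
    refine sum_eq_zero fun S' _ => ?_
    rw [coeff_monomial, if_neg]
    intro h1
    have h2 := congrArg (Finsupp.weight (Sum.elim (fun x : ArcVar n p => if x.1 = r' then 1 else 0)
      (0 : ArcVar n p → ℕ))) h1
    rw [weight_binomialExponent, weight_binomialExponent] at h2
    have h3 : ∑ x ∈ Sᶜ, Sum.elim (fun x : ArcVar n p => if x.1 = r' then 1 else 0)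
      (0 : ArcVar n p → ℕ) (splitVar r r' ε (v g x)) = (univ.filter fun i => s ≤ i).card := by
      rw [← card_row r, card_filter (fun x : Fin p × Fin m => x.1 = r ∧ s ≤ x.2),
        ← sum_subset (subset_univ Sᶜ)]
      · refine sum_congr rfl fun x hx => ?_
        by_cases h4 : x.1 = r
        · have h5 : (v g x).1 = r := h4
          simp [splitVar, h5, h4, shearPartner, hSr x hx h4]
        · have h5 : (v g x).1 ≠ r := h4
          simp [splitVar, h5, h4]
      · intro x _ hx
        rw [notMem_compl] at hx
        refine if_neg fun h4 => ?_
        exact absurd ((mem_filter.1 hx).2.1 h4.1) (not_lt.2 h4.2)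
    have h4 : ∑ x ∈ S, Sum.elim (fun x : ArcVar n p => if x.1 = r' then 1 else 0)
      (0 : ArcVar n p → ℕ) (Sum.inl (v g x)) = (univ.filter fun i => i ≤ s).card := by
      rw [← card_row r', card_filter (fun x : Fin p × Fin m => x.1 = r' ∧ x.2 ≤ s),
        ← sum_subset (subset_univ S)]
      · refine sum_congr rfl fun x hx => ?_
        by_cases h4 : x.1 = r'
        · have h5 : (v g x).1 = r' := h4
          simp [h5, h4, (mem_filter.1 hx).2.2 h4]
        · have h5 : (v g x).1 ≠ r' := h4
          simp [h5, h4]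
      · intro x _ hx
        refine if_neg fun h4 => hx ?_
        exact mem_filter.2 ⟨mem_univ _, fun h5 => absurd (h5.symm.trans h4.1) hr, fun _ => h4.2⟩
    have h5 : ∑ x ∈ S', Sum.elim (fun x : ArcVar n p => if x.1 = r' then 1 else 0)
      (0 : ArcVar n p → ℕ) (Sum.inl (v g' x)) ≤ m := by
      calc _ ≤ ∑ x : Fin p × Fin m, if x.1 = r' then 1 else 0 :=
            sum_le_sum_of_subset (subset_univ S')
        _ = m := by
            have := card_row (m := m) r' (fun _ => True)
            rw [← card_filter]
            simpa only [and_true, filter_true, card_univ, Fintype.card_fin] using this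
    have h6 : (univ.filter fun i : Fin m => s ≤ i).card = m - s := by
      rw [← Fin.card_Ici]
      congr 1
      ext
      simp
    have h7 : (univ.filter fun i : Fin m => i ≤ s).card = s + 1 := by
      rw [← Fin.card_Iic]
      congr 1
      ext
      simp
    have h8 : ∑ x ∈ S'ᶜ, Sum.elim (fun x : ArcVar n p => if x.1 = r' then 1 else 0)
      (0 : ArcVar n p → ℕ) (Sum.inr (shearedVar r r' ε (v g' x))) = 0 := sum_eq_zero fun _ _ => rfl
    rw [h3, h4, h6, h7, h8] at h2
    have := s.2
    omega
  have hL : ∀ g' : Fin p → Fin m → ℕ, coeff t (aeval (fun v => (X (Sum.inl v) + C ((splitCoeff r r' ε v : ℕ) : ℂ) *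
      X (splitVar r r' ε v) : MvPolynomial (ArcVar n p ⊕ ArcVar n p) ℂ))
        (monomial (gridExponent g') (1 : ℂ))) =
      ((∑ S' : Finset (Fin p × Fin m), if binomialExponent Sum.inl (splitVar r r' ε) (v g') S' = t
        then ∏ i ∈ S'ᶜ, splitCoeff r r' ε (v g' i) else 0 : ℕ) : ℂ) := by
    intro g'
    rw [hexp, aeval_binomial_monomial Sum.inl (splitVar r r' ε), coeff_sum, Nat.cast_sum]
    refine sum_congr rfl fun S' _ => ?_
    rw [coeff_monomial]
    split_ifs <;> simp
  have hsplit := congrArg (coeff t) (aeval_split_eq hr ε hf)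
  rw [coeff_aeval, coeff_aeval] at hsplit
  have hzero : ∀ e ∈ f.support, e ≠ gridExponent g → coeff t (aeval (fun v => (X (Sum.inl v) +
      C ((splitCoeff r r' ε v : ℕ) : ℂ) * X (splitVar r r' ε v) :
        MvPolynomial (ArcVar n p ⊕ ArcVar n p) ℂ)) (monomial e (1 : ℂ))) = 0 := by
    intro e he hne
    obtain ⟨g', rfl⟩ := hsupp e he
    rw [hL, Nat.cast_eq_zero]
    refine sum_eq_zero fun S' _ => ?_
    split_ifs with h1
    · by_contra h2
      -- The threshold separates the moved columns, at least `g r s`, from the kept ones of row `r'`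
      -- shifted by `ε * n`; this is where the failing inequality enters.
      refine hne (eq_gridExponent_of_split_eq (S := S) (S' := S') (v := v g) (v' := v g')
        (θ := g r' s + ε * n) hr hl hw (fun _ => rfl)
        (fun _ => rfl) hSε ?_ ?_ ?_ ?_ h1)
      · intro x hx h3
        have h4 := prod_ne_zero_iff.1 h2 x hx
        by_contra h5
        refine h4 (if_neg ?_)
        rintro (h6 | h6)
        · exact h5 h6.2
        · exact hr (h3.symm.trans h6)
      · intro x hx h3
        have h3' : x.1 = r := h3
        show _ ≤ arcColumn (rowVar x.1 (g x.1 x.2))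
        rw [arcColumn_rowVar, h3']
        exact hlt.trans (hm (hSr x hx h3))
      · intro x hx h3
        have h3' : x.1 = r' := h3
        show arcColumn (rowVar x.1 (g x.1 x.2)) + _ ≤ _
        rw [arcColumn_rowVar, h3']
        exact Nat.add_le_add_right (hm' ((mem_filter.1 hx).2.2 h3)) _
      · have h3 := hmax _ he
        rwa [hexp, hexp, weight_sum_single, weight_sum_single] at h3
    · rfl
  rw [sum_eq_single_of_mem _ hg fun e he hne => by rw [hzero e he hne, mul_zero],
    sum_eq_zero fun e he => by
      obtain ⟨g', rfl⟩ := hsupp e he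
      rw [hR, mul_zero]] at hsplit
  -- The surviving coefficient is a sum of natural numbers, and the term of `S` equals one.
  rcases mul_eq_zero.1 hsplit with h1 | h1
  · exact mem_support_iff.1 hg h1
  · rw [hL, Nat.cast_eq_zero] at h1
    have h2 := sum_eq_zero_iff.1 h1 S (mem_univ S)
    rw [if_pos rfl, prod_eq_zero_iff] at h2
    obtain ⟨x, hx, h3⟩ := h2
    have h4 : splitCoeff r r' ε (v g x) = 1 := if_pos <| by
      rcases hSc x hx with h5 | h5
      · exact Or.inl ⟨h5, hSε x hx h5⟩
      · exact Or.inr h5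
    omega

end

/-! ### Cylindric exponents in the span of products of minors. -/

/-- The span of all products of `m` minors whose degrees in `t` add up to `d`. -/
noncomputable def minorProductSpan (n p m d : ℕ) : Submodule ℂ (MvPolynomial (ArcVar n p) ℂ) :=
  Submodule.span ℂ {f | ∃ (I : Fin m → Fin p → Fin n) (k : Fin m → ℕ), ∑ s, k s = d ∧
    f = ∏ s, arcMinor n p (I s) (k s)}

section

variable {n p m d : ℕ}

theorem exists_of_mem_support_prod_arcMinor {I : Fin m → Fin p → Fin n} {k : Fin m → ℕ}
    {e : ArcVar n p →₀ ℕ} (he : e ∈ (∏ s, arcMinor n p (I s) (k s)).support) :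
    ∃ (σ : Fin m → Equiv.Perm (Fin p)) (l : Fin m → Fin p → ℕ), (∀ s, ∑ b, l s b = k s) ∧
      e = ∑ s, ∑ b, Finsupp.single ((σ s b, I s b, l s b) : ArcVar n p) 1 := by
  simp only [arcMinor_eq_sum] at he
  rw [prod_univ_sum, mem_support_iff, coeff_sum] at he
  obtain ⟨φ, hφ, h⟩ := exists_ne_zero_of_sum_ne_zero he
  rw [Fintype.mem_piFinset] at hφ
  have hprod : ∀ (t : Finset (Fin m)) (E : Fin m → ArcVar n p →₀ ℕ) (c : Fin m → ℂ),
      ∏ s ∈ t, monomial (E s) (c s) = monomial (∑ s ∈ t, E s) (∏ s ∈ t, c s) := by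
    intro t E c
    induction t using Finset.induction_on with
    | empty => rfl
    | insert a t ha ih => rw [prod_insert ha, sum_insert ha, prod_insert ha, ih, monomial_mul]
  rw [hprod, coeff_monomial] at h
  refine ⟨fun s => (φ s).1, fun s => (φ s).2, fun s => ?_, ?_⟩
  · have := hφ s
    simp only [mem_product, mem_univ, true_and, mem_finsuppAntidiag, subset_univ, and_true] at this
    exact this
  · by_contra h1
    exact h (if_neg (Ne.symm h1))

theorem arcShear_of_mem_minorProductSpan {r r' : Fin p} (hr : r ≠ r') (ε : ℕ)
    {f : MvPolynomial (ArcVar n p) ℂ} (hf : f ∈ minorProductSpan n p m d) :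
    arcShear r r' ε f = f := by
  induction hf using Submodule.span_induction with
  | mem f hf =>
    obtain ⟨I, k, -, rfl⟩ := hf
    rw [map_prod]
    exact prod_congr rfl fun s _ => arcShear_arcMinor hr ε _ _
  | zero => exact map_zero _
  | add f g _ _ hf hg => rw [map_add, hf, hg]
  | smul c f _ hf => rw [map_smul, hf]

/-- Sequences which increase strictly by less than `n` altogether. -/
def IsCylindric (n : ℕ) {p : ℕ} (G : Fin p → ℕ) : Prop :=
  (∀ r r' : Fin p, (r' : ℕ) = r + 1 → G r < G r') ∧
  ∀ r r' : Fin p, (r : ℕ) = 0 → (r' : ℕ) + 1 = p → G r' < G r + n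

theorem IsCylindric.le {G : Fin p → ℕ} (hG : IsCylindric n G) (r : Fin p) : (r : ℕ) ≤ G r := by
  obtain ⟨r, hr⟩ := r
  induction r with
  | zero => exact Nat.zero_le _
  | succ r ih =>
    have h1 := hG.1 ⟨r, by omega⟩ ⟨r + 1, hr⟩ rfl
    have h2 := ih (by omega)
    simp only at h2 ⊢
    omega

variable [NeZero n]

theorem gridExponent_comp_perm (g : Fin p → Fin m → ℕ) (τ : Fin p → Equiv.Perm (Fin m)) :
    (gridExponent fun r => g r ∘ τ r : ArcVar n p →₀ ℕ) = gridExponent g := by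
  rw [gridExponent, gridExponent, Fintype.sum_prod_type, Fintype.sum_prod_type]
  refine sum_congr rfl fun r _ => ?_
  exact Equiv.sum_comp (τ r) fun s => Finsupp.single (rowVar r (g r s) : ArcVar n p) 1

theorem exists_gridExponent_of_mem_minorProductSpan {f : MvPolynomial (ArcVar n p) ℂ}
    (hf : f ∈ minorProductSpan n p m d) {e : ArcVar n p →₀ ℕ} (he : e ∈ f.support) :
    ∃ g : Fin p → Fin m → ℕ, (∀ r, Monotone (g r)) ∧ ∑ s, ∑ r, g r s / n = d ∧
      e = gridExponent g := by
  have hle : minorProductSpan n p m d ≤ restrictSupport ℂ {e | ∃ g : Fin p → Fin m → ℕ,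
      (∀ r, Monotone (g r)) ∧ ∑ s, ∑ r, g r s / n = d ∧ e = gridExponent g} := by
    refine Submodule.span_le.2 ?_
    rintro f ⟨I, k, hk, rfl⟩
    rw [SetLike.mem_coe, mem_restrictSupport_iff]
    intro e he
    obtain ⟨σ, l, hl, rfl⟩ := exists_of_mem_support_prod_arcMinor he
    let g : Fin p → Fin m → ℕ := fun r s =>
      arcColumn ((r, I s ((σ s).symm r), l s ((σ s).symm r)) : ArcVar n p)
    have hg : ∀ r s, (rowVar r (g r s) : ArcVar n p) =
        (r, I s ((σ s).symm r), l s ((σ s).symm r)) := fun r s =>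
      rowVar_arcColumn ((r, I s ((σ s).symm r), l s ((σ s).symm r)) : ArcVar n p)
    refine ⟨fun r => g r ∘ Tuple.sort (g r), fun r => Tuple.monotone_sort (g r), ?_, ?_⟩
    · rw [sum_comm]
      have h1 : ∀ r, ∑ s, (g r ∘ Tuple.sort (g r)) s / n = ∑ s, g r s / n := fun r =>
        Equiv.sum_comp (Tuple.sort (g r)) fun s => g r s / n
      simp only [h1]
      rw [sum_comm, ← hk]
      refine sum_congr rfl fun s _ => ?_
      rw [← hl s, ← Equiv.sum_comp (σ s).symm (fun b => l s b)]
      refine sum_congr rfl fun r _ => ?_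
      exact congrArg (fun v : ArcVar n p => v.2.2) (hg r s)
    · rw [gridExponent_comp_perm, gridExponent, Fintype.sum_prod_type_right]
      refine sum_congr rfl fun s _ => ?_
      simp only [hg]
      rw [← Equiv.sum_comp (σ s) (fun r => Finsupp.single (r, I s ((σ s).symm r), _) 1)]
      simp
  exact (mem_restrictSupport_iff _).1 (hle hf) he

/-- A weight on the variables, quadratic in the distance from the diagonal. -/
def diagonalWeight {n p : ℕ} (v : ArcVar n p) : ℤ :=
  -((p : ℤ) * arcColumn v - n * (v.1 : ℕ)) ^ 2

/-- Each shear used, `r` to `r + 1` with `ε = 0` and the last row to the first with `ε = 1`, lowers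
`p * column - n * row` by exactly `n`. So a single quadratic weight serves all of them, and one
maximal monomial satisfies every cylindric inequality. -/
theorem exists_isCylindric_of_mem_minorProductSpan (hp : 1 ≤ p) {f : MvPolynomial (ArcVar n p) ℂ}
    (hf : f ∈ minorProductSpan n p m d) (hne : f ≠ 0) :
    ∃ g : Fin p → Fin m → ℕ, (∀ r, Monotone (g r)) ∧ (∀ s, IsCylindric n fun r => g r s) ∧
      ∑ s, ∑ r, g r s / n = d ∧ coeff (gridExponent g) f ≠ 0 := by
  have hn : (0 : ℤ) < n := by exact_mod_cast NeZero.pos n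
  have hp' : (0 : ℤ) < p := by exact_mod_cast hp
  obtain ⟨e, he, hmax⟩ := exists_max_image f.support
    (fun e => Finsupp.weight (diagonalWeight : ArcVar n p → ℤ) e) (support_nonempty.2 hne)
  obtain ⟨g, hg, hd, rfl⟩ := exists_gridExponent_of_mem_minorProductSpan hf he
  have hsupp : ∀ e ∈ f.support, ∃ g : Fin p → Fin m → ℕ, e = gridExponent g := fun e he => by
    obtain ⟨g, -, -, h⟩ := exists_gridExponent_of_mem_minorProductSpan hf he
    exact ⟨g, h⟩
  refine ⟨g, hg, fun s => ⟨fun r r' hr => ?_, fun r r' hr hr' => ?_⟩, hd, mem_support_iff.1 he⟩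
  · have hne : r ≠ r' := fun h => by
      rw [h] at hr
      omega
    have := lt_of_mem_support_of_isMax (ε := 0) hne (arcShear_of_mem_minorProductSpan hne 0 hf)
      -- With `u = p * c - n * r` the change of weight is `(u - n) ^ 2 - u ^ 2 = n ^ 2 - 2 * n * u`.
      hsupp (w := diagonalWeight) (κ := 2 * n ^ 2 * (r : ℕ) + n ^ 2) (l := 2 * n * p)
      (by positivity) ?_ he hmax (hg r) (hg r') s
    · simpa using this
    · intro v hv h0
      have h1 := arcColumn_shearPartner r' h0
      have h2 : ((shearPartner r' 0 v).1 : ℕ) = r + 1 := hr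
      simp only [zero_mul, add_zero] at h1
      simp only [diagonalWeight, h1, h2, hv]
      push_cast
      ring
  · by_cases hne : r' = r
    · subst hne
      have := NeZero.pos n
      omega
    have := lt_of_mem_support_of_isMax (ε := 1) hne (arcShear_of_mem_minorProductSpan hne 1 hf)
      hsupp (w := diagonalWeight) (κ := 2 * n ^ 2 * p - n ^ 2) (l := 2 * n * p)
      (by positivity) ?_ he hmax (hg r') (hg r) s
    · simpa using this
    · intro v hv h0
      have h1 : (arcColumn v : ℤ) = arcColumn (shearPartner r 1 v) + n := by
        rw [← arcColumn_shearPartner r h0]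
        push_cast
        ring
      have h2 : ((shearPartner r 1 v).1 : ℕ) = 0 := hr
      have h3 : ((v.1 : ℕ) : ℤ) = p - 1 := by
        rw [hv]
        omega
      simp only [diagonalWeight, h1, h2, h3]
      push_cast
      ring

end

/-! ### Cylindric sequences as order ideals. -/

section

variable {n p : ℕ} [NeZero p]

/-- The extension of a sequence of length `p` to all heights, decreasing by `n` in `p` steps. -/
def cylindricExtension (n : ℕ) (G : Fin p → ℕ) (a : ℕ) : ℤ :=
  (G (Fin.rev ⟨a % p, Nat.mod_lt _ (NeZero.pos p)⟩) : ℤ) - n * (a / p : ℕ)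

theorem cylindricExtension_add_mul (G : Fin p → ℕ) (r : Fin p) (l : ℕ) :
    cylindricExtension n G (r + p * l) = (G r.rev : ℤ) - n * l := by
  have hp : 0 < p := NeZero.pos p
  have h1 : (⟨((r : ℕ) + p * l) % p, Nat.mod_lt _ hp⟩ : Fin p) = r :=
    Fin.ext (by simp only; rw [Nat.add_mul_mod_self_left, Nat.mod_eq_of_lt r.2])
  rw [cylindricExtension, h1, Nat.add_mul_div_left _ _ hp, Nat.div_eq_of_lt r.2, zero_add]

theorem exists_eq_add_mul (p : ℕ) [NeZero p] (a : ℕ) : ∃ (r : Fin p) (l : ℕ), a = r + p * l :=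
  ⟨⟨a % p, Nat.mod_lt _ (NeZero.pos p)⟩, a / p, (Nat.mod_add_div a p).symm⟩

theorem cylindricExtension_add_period (G : Fin p → ℕ) (a : ℕ) :
    cylindricExtension n G (a + p) = cylindricExtension n G a - n := by
  obtain ⟨r, l, rfl⟩ := exists_eq_add_mul p a
  rw [add_assoc, ← Nat.mul_succ, cylindricExtension_add_mul, cylindricExtension_add_mul]
  push_cast
  ring

theorem cylindricExtension_succ_lt {G : Fin p → ℕ} (hG : IsCylindric n G) (a : ℕ) :
    cylindricExtension n G (a + 1) < cylindricExtension n G a := by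
  have hp : 0 < p := NeZero.pos p
  obtain ⟨r, l, rfl⟩ := exists_eq_add_mul p a
  by_cases h : (r : ℕ) + 1 < p
  · have h1 := cylindricExtension_add_mul (n := n) G ⟨r + 1, h⟩ l
    rw [show (r : ℕ) + p * l + 1 = r + 1 + p * l by ring, cylindricExtension_add_mul]
    simp only at h1
    rw [h1]
    have h2 := hG.1 (Fin.rev ⟨r + 1, h⟩) r.rev (by simp only [Fin.val_rev]; omega)
    omega
  · have h1 := cylindricExtension_add_mul (n := n) G ⟨0, hp⟩ (l + 1)
    have hr := r.2
    rw [show (r : ℕ) + p * l + 1 = 0 + p * (l + 1) by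
      rw [Nat.mul_succ]; omega, cylindricExtension_add_mul]
    simp only at h1
    rw [h1]
    have h2 := hG.2 r.rev (Fin.rev ⟨0, hp⟩) (by simp only [Fin.val_rev]; omega)
      (by simp only [Fin.val_rev]; omega)
    push_cast
    rw [mul_add]
    omega

theorem add_cylindricExtension_antitone {G : Fin p → ℕ} (hG : IsCylindric n G) :
    Antitone fun a : ℕ => (a : ℤ) + cylindricExtension n G a :=
  antitone_nat_of_succ_le fun a => by
    have := cylindricExtension_succ_lt hG a
    push_cast
    omega

/-- The order ideal attached to a cylindric sequence. -/
def cylindricIdeal (n : ℕ) (G : Fin p → ℕ) : Set (CylPoset n p) :=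
  {x | x.j - x.i ≤ cylindricExtension n G (x.i - 1).toNat}

theorem isLowerSet_cylindricIdeal (hpn : p < n) {G : Fin p → ℕ} (hG : IsCylindric n G) :
    IsLowerSet (cylindricIdeal n G) := by
  intro y x hxy hy
  have hx1 := x.one_le_i
  have hx2 := x.i_le_j
  have hx3 := x.j_le
  have hy1 := y.one_le_i
  have hy2 := y.i_le_j
  have hy3 := y.j_le
  have hanti := add_cylindricExtension_antitone hG
  have hy' : y.j - y.i ≤ cylindricExtension n G (y.i - 1).toNat := hy
  show x.j - x.i ≤ cylindricExtension n G (x.i - 1).toNat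
  rw [CylPoset.le_def] at hxy
  have h1 : x.i ≤ y.i → y.j ≤ x.i + cylindricExtension n G (x.i - 1).toNat := fun h => by
    have := hanti (show (x.i - 1).toNat ≤ (y.i - 1).toNat by omega)
    simp only at this
    omega
  have h2 : x.i + p ≤ y.i → y.j ≤ x.i + cylindricExtension n G (x.i - 1).toNat + p - n :=
    fun h => by
      have := hanti (show (x.i - 1).toNat + p ≤ (y.i - 1).toNat by omega)
      simp only [cylindricExtension_add_period] at this
      push_cast at this
      omega
  rcases hxy with ⟨h3, h4⟩ | h3 | h3
  · have := h1 h3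
    omega
  · have := h2 h3
    omega
  · by_cases h4 : x.i ≤ y.i
    · have := h1 h4
      omega
    · have := hanti (show (x.i - 1).toNat ≤ (y.i - 1).toNat + p by omega)
      simp only [cylindricExtension_add_period] at this
      push_cast at this
      omega

theorem finite_cylindricIdeal {G : Fin p → ℕ} (hG : IsCylindric n G) :
    (cylindricIdeal n G).Finite := by
  have hlin : ∀ a : ℕ, (a : ℤ) + cylindricExtension n G a ≤ cylindricExtension n G 0 := fun a => by
    simpa using add_cylindricExtension_antitone hG (Nat.zero_le a)
  refine CylPoset.finite_of_i_le (cylindricExtension n G 0 + 1) fun x hx => ?_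
  have h1 : x.j - x.i ≤ cylindricExtension n G (x.i - 1).toNat := hx
  have h2 := hlin (x.i - 1).toNat
  have := x.one_le_i
  have := x.i_le_j
  omega

theorem cylindricIdeal_mono {G G' : Fin p → ℕ} (h : ∀ r, G r ≤ G' r) :
    cylindricIdeal n G ⊆ cylindricIdeal n G' := by
  intro x hx
  refine le_trans (show x.j - x.i ≤ _ from hx) ?_
  have := h (Fin.rev ⟨(x.i - 1).toNat % p, Nat.mod_lt _ (NeZero.pos p)⟩)
  unfold cylindricExtension
  omega

/-- The value `G r` is read off from an extremal element of the ideal in the row where the periodic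
extension equals `G r % n`. -/
theorem cylindricIdeal_le (hpn : p < n) {G G' : Fin p → ℕ} (hG' : IsCylindric n G')
    (h : cylindricIdeal n G ⊆ cylindricIdeal n G') (r : Fin p) : G r ≤ G' r := by
  by_contra hlt
  have h0 := hG'.le r
  have hn : 0 < n := by omega
  have hr := r.2
  have h1 := Nat.mod_add_div (G r) n
  have h2 := Nat.mod_lt (G r) hn
  have h3 : G r / n = 0 ∨ p ≤ p * (G r / n) := by
    rcases Nat.eq_zero_or_pos (G r / n) with h | h
    · exact Or.inl h
    · exact Or.inr (Nat.le_mul_of_pos_right _ h)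
  -- If the quotient is zero, the element belongs to the poset only because `G r > G' r ≥ r`.
  have h4 : (p : ℤ) + 1 ≤ ((r.rev : ℕ) + p * (G r / n) + 1 : ℕ) + (G r % n : ℕ) := by
    rw [Fin.val_rev]
    rcases h3 with h3 | h3
    · rw [h3] at h1 ⊢
      omega
    · omega
  let x : CylPoset n p := ⟨((r.rev : ℕ) + p * (G r / n) + 1 : ℕ),
    ((r.rev : ℕ) + p * (G r / n) + 1 : ℕ) + (G r % n : ℕ), by omega, h4, by omega, by omega⟩
  have hxi : (x.i - 1).toNat = (r.rev : ℕ) + p * (G r / n) := by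
    simp only [x]
    omega
  have hxj : x.j - x.i = (G r % n : ℕ) := by
    simp only [x]
    omega
  have h5 : ((G r : ℕ) : ℤ) = (G r % n : ℕ) + n * (G r / n : ℕ) := by exact_mod_cast h1.symm
  have hx : x ∈ cylindricIdeal n G := by
    show x.j - x.i ≤ _
    rw [hxi, hxj, cylindricExtension_add_mul, Fin.rev_rev]
    omega
  have hx' : x.j - x.i ≤ _ := h hx
  rw [hxi, hxj, cylindricExtension_add_mul, Fin.rev_rev] at hx'
  omega

theorem cylindricIdeal_injective (hpn : p < n) {G G' : Fin p → ℕ} (hG : IsCylindric n G)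
    (hG' : IsCylindric n G') (h : cylindricIdeal n G = cylindricIdeal n G') : G = G' :=
  funext fun r => le_antisymm (cylindricIdeal_le hpn hG' h.subset r)
    (cylindricIdeal_le hpn hG h.symm.subset r)

/-- Matches the degree in `t` with the shift: counting diagonal elements gives `G r / n = (k + r) /
p`, and these quotients add up to `k`. -/
theorem sum_div_eq_of_cylindricIdeal_eq (hpn : p < n) {G : Fin p → ℕ} {k : ℕ} {β : Fin p → ℤ}
    (h : cylindricIdeal n G = tupleIdeal n p k β) : ∑ r, G r / n = k := by
  have hp : 0 < p := NeZero.pos p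
  have hn : 0 < n := by omega
  -- Both sides test whether `q_{a+1,a+1}` is in the ideal; for `a < p` this is no element of the
  -- poset, but both sides hold.
  have hdiag : ∀ a : ℕ, 0 ≤ cylindricExtension n G a ↔ a < k + p := by
    intro a
    by_cases ha : a < p
    · have h1 := cylindricExtension_add_mul (n := n) G ⟨a, ha⟩ 0
      simp only [mul_zero, add_zero, Nat.cast_zero, sub_zero] at h1
      rw [h1]
      omega
    · let x : CylPoset n p := ⟨a + 1, a + 1, by omega, by omega, by omega, by omega⟩
      have h1 : x ∈ cylindricIdeal n G ↔ 0 ≤ cylindricExtension n G a := by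
        show x.j - x.i ≤ cylindricExtension n G (x.i - 1).toNat ↔ _
        simp [x]
      have h2 : x ∈ tupleIdeal n p k β ↔ a < k + p := by
        constructor
        · rintro (h3 | h3 | ⟨b, -, h3, -⟩)
          · simp only [x] at h3
            omega
          · simp only [x] at h3
            omega
          · have := b.2
            simp only [x] at h3
            omega
        · intro h3
          exact Or.inr (Or.inl (by simp only [x]; omega))
      rw [← h1, ← h2, h]
  have hdiv : ∀ r : Fin p, G r / n = (k + (r : ℕ)) / p := by
    intro r
    have key : ∀ l : ℕ, l ≤ G r / n ↔ l ≤ (k + (r : ℕ)) / p := by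
      intro l
      have h1 := hdiag ((r.rev : ℕ) + p * l)
      rw [cylindricExtension_add_mul, Fin.rev_rev, Fin.val_rev] at h1
      have h2 := r.2
      rw [Nat.le_div_iff_mul_le hn, Nat.le_div_iff_mul_le hp, mul_comm l n, mul_comm l p]
      have h3 : ((n * l : ℕ) : ℤ) = n * l := by push_cast; rfl
      omega
    exact le_antisymm ((key _).1 le_rfl) ((key _).2 le_rfl)
  rw [sum_congr rfl fun r _ => hdiv r]
  exact sum_add_div_eq p k hp

end

/-! ### The dimension count, the bases and the character. -/

theorem exists_basis_of_span_eq {ι K V : Type*} [Field K] [AddCommGroup V] [Module K V]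
    {v : ι → V} (hv : LinearIndependent K v) {W : Submodule K V}
    (hW : Submodule.span K (Set.range v) = W) :
    ∃ b : Module.Basis ι K W, ∀ i, (b i : V) = v i := by
  subst hW
  exact ⟨Module.Basis.span hv, fun i => congrArg Subtype.val (Module.Basis.span_apply hv i)⟩

namespace SemiInfTableau

variable {n p m d : ℕ}

theorem finite_isPBWSemistandard (n p m d : ℕ) :
    {T : SemiInfTableau p m | T.IsPBWSemistandard n ∧ ∑ i, T.shift i = d}.Finite := by
  refine Set.Finite.of_finite_image (f := fun T => (T.shift, T.content)) ?_ ?_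
  · refine Set.Finite.subset ((Set.Finite.pi' fun _ : Fin m => Set.finite_Iic d).prod
      (Set.Finite.pi' fun _ : Fin m => Set.Finite.pi' fun _ : Fin p =>
        Set.finite_Icc (0 : ℤ) (d + n))) ?_
    rintro _ ⟨T, ⟨hT, hd⟩, rfl⟩
    have hs : ∀ i, T.shift i ≤ d := fun i => by
      rw [← hd]
      exact single_le_sum (f := T.shift) (fun _ _ => Nat.zero_le _) (mem_univ i)
    refine ⟨hs, fun i j => ?_⟩
    have h1 := (hT.isPBWTuple i).1 j
    have h2 := hs i
    simp only [content_eq, Set.mem_Icc]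
    omega
  · intro T _ T' _ h
    exact SemiInfTableau.ext (congrArg Prod.fst h) (congrArg Prod.snd h)

theorem isWeightedHomogeneous_arcMinor (I : Fin p → Fin n) (k : ℕ) :
    IsWeightedHomogeneous (arcWeight n p) (arcMinor n p I k) (∑ b, Pi.single (I b) 1, k) := by
  rw [arcMinor_eq_sum, ← mem_weightedHomogeneousSubmodule]
  refine Submodule.sum_mem _ fun x hx => ?_
  simp only [mem_product, mem_univ, true_and, mem_finsuppAntidiag, subset_univ, and_true] at hx
  refine isWeightedHomogeneous_monomial _ _ _ ?_
  rw [weight_sum_single]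
  exact Prod.ext (by rw [Prod.fst_sum]; rfl) (by rw [Prod.snd_sum]; exact hx)

variable [NeZero n]

theorem linearIndependent_minorProduct_subtype [NeZero p] (hpn : p < n)
    {Q : SemiInfTableau p m → Prop} (hQ : ∀ T, Q T → T.IsPBWSemistandard n) :
    LinearIndependent ℂ fun T : {T // Q T} => T.1.minorProduct n := by
  let φ : {T // Q T} → Σ m : ℕ, {T : SemiInfTableau p m // T.IsPBWSemistandard n} :=
    fun T => ⟨m, T.1, hQ T.1 T.2⟩
  have hφ : Function.Injective φ := fun T T' h => by
    have h1 : (⟨T.1, hQ T.1 T.2⟩ : {T : SemiInfTableau p m // T.IsPBWSemistandard n}) =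
        ⟨T'.1, hQ T'.1 T'.2⟩ := eq_of_heq (Sigma.mk.inj h).2
    exact Subtype.ext (Subtype.mk.inj h1)
  exact (linearIndependent_minorProduct hpn).comp φ hφ

theorem minorProduct_mem_minorProductSpan (T : SemiInfTableau p m) :
    T.minorProduct n ∈ minorProductSpan n p m (∑ i, T.shift i) :=
  Submodule.subset_span ⟨_, _, rfl, rfl⟩

theorem exists_tableau_of_grid (hp : 1 ≤ p) (hpn : p < n) {g : Fin p → Fin m → ℕ}
    (hg : ∀ r, Monotone (g r)) (hg' : ∀ s, IsCylindric n fun r => g r s)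
    (hd : ∑ s, ∑ r, g r s / n = d) [NeZero p] :
    ∃ T : SemiInfTableau p m, (T.IsPBWSemistandard n ∧ ∑ i, T.shift i = d) ∧
      ∀ s, tupleIdeal n p (T.shift s) (T.tuple s) = cylindricIdeal n fun r => g r s := by
  obtain ⟨T, hT, h⟩ := (bijOn_pbwIdeal hp hpn m).surjOn
    (show (fun s => cylindricIdeal n fun r => g r s) ∈ _ from
      ⟨fun s s' hs => cylindricIdeal_mono fun r => hg r hs, fun s =>
        ⟨finite_cylindricIdeal (hg' s), isLowerSet_cylindricIdeal hpn (hg' s)⟩⟩)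
  have h' : ∀ s, tupleIdeal n p (T.shift s) (T.tuple s) = cylindricIdeal n fun r => g r s :=
    fun s => by
      rw [← pbwIdeal_columnTuple hp hT]
      exact congrFun h s
  refine ⟨T, ⟨hT, ?_⟩, h'⟩
  rw [← hd]
  exact sum_congr rfl fun s _ => (sum_div_eq_of_cylindricIdeal_eq hpn (h' s).symm).symm

/-- Fixing `d` makes everything finite. Reading coefficients at cylindric exponents embeds the span
into functions on chains `Γ`, which inject into the tableaux `P`, so the independent products of `P`
exhaust it. -/
theorem minorProductSpan_eq_span (hp : 1 ≤ p) (hpn : p < n) (m d : ℕ) :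
    minorProductSpan n p m d = Submodule.span ℂ (Set.range
      fun T : {T : SemiInfTableau p m // T.IsPBWSemistandard n ∧ ∑ i, T.shift i = d} =>
        T.1.minorProduct n) := by
  have : NeZero p := ⟨by omega⟩
  let P := {T : SemiInfTableau p m // T.IsPBWSemistandard n ∧ ∑ i, T.shift i = d}
  let Γ := {g : Fin p → Fin m → ℕ // (∀ r, Monotone (g r)) ∧ (∀ s, IsCylindric n fun r => g r s) ∧
    ∑ s, ∑ r, g r s / n = d}
  have hPf : Finite P := finite_isPBWSemistandard n p m d
  choose ψ hψ hψ' using fun g : Γ =>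
    exists_tableau_of_grid hp hpn g.2.1 g.2.2.1 g.2.2.2
  have hinj : Function.Injective fun g : Γ => (⟨ψ g, hψ g⟩ : P) := by
    intro g g' h
    simp only [Subtype.mk.injEq] at h
    refine Subtype.ext (funext fun r => funext fun s => ?_)
    have h1 := hψ' g s
    rw [h, hψ' g' s] at h1
    exact congrFun (cylindricIdeal_injective hpn (g'.2.2.1 s) (g.2.2.1 s) h1).symm r
  have hΓf : Finite Γ := Finite.of_injective _ hinj
  have hcard : Nat.card Γ ≤ Nat.card P := Nat.card_le_card_of_injective _ hinj
  have := Fintype.ofFinite Γ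
  have := Fintype.ofFinite P
  let Φ : minorProductSpan n p m d →ₗ[ℂ] (Γ → ℂ) :=
    LinearMap.pi fun g => (lcoeff ℂ (gridExponent g.1)).comp (Submodule.subtype _)
  have hΦ : Function.Injective Φ := by
    rw [injective_iff_map_eq_zero]
    rintro ⟨f, hf⟩ h0
    by_contra hne
    obtain ⟨g, h1, h2, h3, h4⟩ := exists_isCylindric_of_mem_minorProductSpan hp hf
      fun h => hne (Subtype.ext h)
    exact h4 (congrFun h0 ⟨g, h1, h2, h3⟩)
  have hfin : Module.Finite ℂ (minorProductSpan n p m d) := Module.Finite.of_injective Φ hΦ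
  have hle : Submodule.span ℂ (Set.range fun T : P => T.1.minorProduct n) ≤
      minorProductSpan n p m d := by
    refine Submodule.span_le.2 ?_
    rintro _ ⟨T, rfl⟩
    have := minorProduct_mem_minorProductSpan (n := n) T.1
    rwa [T.2.2] at this
  have hli : LinearIndependent ℂ fun T : P => T.1.minorProduct n :=
    linearIndependent_minorProduct_subtype hpn fun T hT => hT.1
  refine (Submodule.eq_of_le_of_finrank_le hle ?_).symm
  calc Module.finrank ℂ (minorProductSpan n p m d) ≤ Module.finrank ℂ (Γ → ℂ) :=
        LinearMap.finrank_le_finrank_of_injective hΦ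
    _ = Nat.card Γ := by rw [Module.finrank_fintype_fun_eq_card, Nat.card_eq_fintype_card]
    _ ≤ Nat.card P := hcard
    _ = _ := by rw [finrank_span_eq_card hli, Nat.card_eq_fintype_card]

theorem semiInfPluckerComponent_eq_span (hp : 1 ≤ p) (hpn : p < n) (m : ℕ) :
    Submodule.span ℂ (Set.range fun T : {T : SemiInfTableau p m // T.IsPBWSemistandard n} =>
      T.1.minorProduct n) = semiInfPluckerComponent n p m := by
  rw [semiInfPluckerComponent, Submodule.span_pow]
  refine le_antisymm (Submodule.span_mono ?_) (Submodule.span_le.2 ?_)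
  · rintro _ ⟨T, rfl⟩
    refine Set.mem_pow.2 ⟨fun i => ⟨_, T.1.columnTuple n i, T.1.shift i, rfl⟩, ?_⟩
    rw [List.prod_ofFn]
    rfl
  · intro f hf
    obtain ⟨φ, rfl⟩ := Set.mem_pow.1 hf
    choose I k hIk using fun i => (φ i).2
    have h1 : (List.ofFn fun i => (φ i : MvPolynomial (ArcVar n p) ℂ)).prod ∈
        minorProductSpan n p m (∑ i, k i) := by
      refine Submodule.subset_span ⟨I, k, rfl, ?_⟩
      rw [List.prod_ofFn]
      exact prod_congr rfl fun i _ => hIk i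
    rw [minorProductSpan_eq_span hp hpn] at h1
    refine Submodule.span_mono ?_ h1
    rintro _ ⟨T, rfl⟩
    exact ⟨⟨T.1, T.2.1⟩, rfl⟩

theorem semiInfPlucker_eq_span (hp : 1 ≤ p) (hpn : p < n) :
    Submodule.span ℂ (Set.range fun x : Σ m : ℕ,
      {T : SemiInfTableau p m // T.IsPBWSemistandard n} => x.2.1.minorProduct n) =
      Subalgebra.toSubmodule (semiInfPlucker n p) := by
  apply le_antisymm
  · refine Submodule.span_le.2 ?_
    rintro _ ⟨x, rfl⟩
    exact Subalgebra.prod_mem _ fun i _ => Algebra.subset_adjoin ⟨_, _, rfl⟩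
  · rw [semiInfPlucker, Algebra.adjoin_eq_span]
    refine Submodule.span_le.2 fun f hf => ?_
    have hmem : ∃ m, f ∈ semiInfPluckerComponent n p m := by
      induction hf using Submonoid.closure_induction with
      | mem f hf => exact ⟨1, by
          rw [semiInfPluckerComponent, pow_one]
          exact Submodule.subset_span hf⟩
      | one => exact ⟨0, by
          rw [semiInfPluckerComponent, pow_zero]
          exact Submodule.one_le.1 le_rfl⟩
      | mul f g _ _ hf hg =>
        obtain ⟨a, ha⟩ := hf
        obtain ⟨b, hb⟩ := hg
        refine ⟨a + b, ?_⟩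
        rw [semiInfPluckerComponent, pow_add]
        exact Submodule.mul_mem_mul ha hb
    obtain ⟨m, hm⟩ := hmem
    rw [← semiInfPluckerComponent_eq_span hp hpn] at hm
    refine Submodule.span_mono ?_ hm
    rintro _ ⟨T, rfl⟩
    exact ⟨⟨m, T⟩, rfl⟩

theorem isWeightedHomogeneous_minorProduct (T : SemiInfTableau p m) :
    IsWeightedHomogeneous (arcWeight n p) (T.minorProduct n)
      (T.multiplicity n, ∑ i, T.shift i) := by
  have h := IsWeightedHomogeneous.prod univ (fun i => arcMinor n p (T.columnTuple n i) (T.shift i))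
    _ fun i _ => isWeightedHomogeneous_arcMinor (T.columnTuple n i) (T.shift i)
  have h1 : ∑ i, ((∑ b, Pi.single (T.columnTuple n i b) 1, T.shift i) : (Fin n → ℕ) × ℕ) =
      (T.multiplicity n, ∑ i, T.shift i) := by
    refine Prod.ext ?_ (by rw [Prod.snd_sum])
    rw [Prod.fst_sum]
    funext c
    simp only [multiplicity, card_filter, Fintype.sum_prod_type, Finset.sum_apply, Pi.single_apply]
    exact sum_congr rfl fun i _ => sum_congr rfl fun b _ => if_congr eq_comm rfl rfl
  rw [h1] at h
  exact h

/-- Projecting a combination of products to the weight `(μ, d)` keeps the products of that weight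
and kills the others, each product being homogeneous. -/
theorem inf_weightedHomogeneousSubmodule_eq_span (hp : 1 ≤ p) (hpn : p < n) (m d : ℕ)
    (μ : Fin n → ℕ) :
    semiInfPluckerComponent n p m ⊓ weightedHomogeneousSubmodule ℂ (arcWeight n p) (μ, d) =
      Submodule.span ℂ (Set.range fun T : {T : SemiInfTableau p m // T.IsPBWSemistandard n ∧
        ∑ i, T.shift i = d ∧ ∀ c, T.multiplicity n c = μ c} => T.1.minorProduct n) := by
  classical
  rw [← semiInfPluckerComponent_eq_span hp hpn]
  apply le_antisymm
  · rintro f ⟨hf, hw⟩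
    obtain ⟨c, rfl⟩ := Finsupp.mem_span_range_iff_exists_finsupp.1 hf
    rw [← IsWeightedHomogeneous.weightedHomogeneousComponent_same
      ((mem_weightedHomogeneousSubmodule _ _ _ _).1 hw), Finsupp.sum, map_sum]
    refine Submodule.sum_mem _ fun T _ => ?_
    rw [map_smul, weightedHomogeneousComponent_of_mem
      ((mem_weightedHomogeneousSubmodule _ _ _ _).2 (isWeightedHomogeneous_minorProduct T.1))]
    refine Submodule.smul_mem _ _ ?_
    split_ifs with h
    · rw [Prod.mk.injEq] at h
      exact Submodule.subset_span ⟨⟨T.1, T.2, h.2.symm, fun c => (congrFun h.1 c).symm⟩, rfl⟩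
    · exact Submodule.zero_mem _
  · refine Submodule.span_le.2 ?_
    rintro _ ⟨T, rfl⟩
    refine ⟨Submodule.subset_span ⟨⟨T.1, T.2.1⟩, rfl⟩, ?_⟩
    have h := isWeightedHomogeneous_minorProduct (n := n) T.1
    rw [T.2.2.1, show T.1.multiplicity n = μ from funext T.2.2.2] at h
    exact h

end SemiInfTableau

end

theorem theorem4 (n p : ℕ) [NeZero n] (hp : 1 ≤ p) (hpn : p < n) :
    -- the products indexed by all PBW-semistandard tableaux form a basis of the algebra
    (∃ b : Module.Basis (Σ m : ℕ, {T : SemiInfTableau p m // T.IsPBWSemistandard n}) ℂ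
        (semiInfPlucker n p),
      ∀ x, (b x : MvPolynomial (ArcVar n p) ℂ) = x.2.1.minorProduct n) ∧
    -- those with `m` columns form a basis of the homogeneous component of degree `m`
    (∀ m : ℕ, ∃ b : Module.Basis {T : SemiInfTableau p m // T.IsPBWSemistandard n} ℂ
        (semiInfPluckerComponent n p m),
      ∀ T, (b T : MvPolynomial (ArcVar n p) ℂ) = T.1.minorProduct n) ∧
    -- the tableaux correspond to weakly increasing sequences of finite order ideals
    (∀ m : ℕ, Set.BijOn
      (fun (T : SemiInfTableau p m) (i : Fin m) => pbwIdeal n p (T.columnTuple n i) (T.shift i))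
      {T | T.IsPBWSemistandard n}
      {J : Fin m → Set (CylPoset n p) |
        Monotone J ∧ ∀ i, (J i).Finite ∧ IsLowerSet (J i)}) ∧
    -- the graded character of the homogeneous component of degree `m`
    (∀ (m : ℕ) (μ : Fin n → ℕ) (d : ℕ),
      {T : SemiInfTableau p m | T.IsPBWSemistandard n ∧ ∑ i, T.shift i = d ∧
        ∀ c, T.multiplicity n c = μ c}.Finite ∧
      Module.rank ℂ
        ↥(semiInfPluckerComponent n p m ⊓
          MvPolynomial.weightedHomogeneousSubmodule ℂ (arcWeight n p) (μ, d)) =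
        (({T : SemiInfTableau p m | T.IsPBWSemistandard n ∧ ∑ i, T.shift i = d ∧
          ∀ c, T.multiplicity n c = μ c}.ncard : ℕ) : Cardinal)) := by
  have : NeZero p := ⟨by omega⟩
  have hli := SemiInfTableau.linearIndependent_minorProduct (n := n) hpn
  refine ⟨?_, fun m => ?_, SemiInfTableau.bijOn_pbwIdeal hp hpn, fun m μ d => ⟨?_, ?_⟩⟩
  · obtain ⟨b, hb⟩ := exists_basis_of_span_eq hli (SemiInfTableau.semiInfPlucker_eq_span hp hpn)
    exact ⟨b.map (Subalgebra.toSubmoduleEquiv (semiInfPlucker n p)), hb⟩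
  · exact exists_basis_of_span_eq
      (SemiInfTableau.linearIndependent_minorProduct_subtype hpn fun T hT => hT)
      (SemiInfTableau.semiInfPluckerComponent_eq_span hp hpn m)
  · exact (SemiInfTableau.finite_isPBWSemistandard n p m d).subset fun T hT => ⟨hT.1, hT.2.1⟩
  · have hfin : {T : SemiInfTableau p m | T.IsPBWSemistandard n ∧ ∑ i, T.shift i = d ∧
        ∀ c, T.multiplicity n c = μ c}.Finite :=
      (SemiInfTableau.finite_isPBWSemistandard n p m d).subset fun T hT => ⟨hT.1, hT.2.1⟩
    have hli' := SemiInfTableau.linearIndependent_minorProduct_subtype (n := n) hpn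
      (Q := fun T : SemiInfTableau p m => T.IsPBWSemistandard n ∧ ∑ i, T.shift i = d ∧
        ∀ c, T.multiplicity n c = μ c) fun T hT => hT.1
    rw [SemiInfTableau.inf_weightedHomogeneousSubmodule_eq_span hp hpn, rank_span hli',
      Cardinal.mk_range_eq _ hli'.injective, Set.cast_ncard hfin]
    rfl
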